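/- **Theorem 2.2.** Consider the single chirp model $$y(t)=A^0\cos(\theta_1^0t+\theta_2^0t^2)+B^0\sin(\theta_1^0t+\theta_2^0t^2)+e(t),\qquad t=1,2,\ldots,$$ where $e(1),e(2),\ldots$ are i.i.d. real random variables with mean zero and $E|e(1)|^{1+\delta}<\infty$ for some $0<\delta<1$. Let $\Theta\subseteq\mathbb R^4$ be the parameter space of vectors $\xi=(A,B,\theta_1,\theta_2)$, and let $T\subseteq\mathbb R^2$ be its projection onto the coordinates $\theta=(\theta_1,\theta_2)$. Assume that the frequency parameters are identifiable on $\Theta$: for distinct $\theta,\theta'\in T$ the two families of sequences $$\bigl\{(A\cos(\theta_1t+\theta_2t^2)+B\sin(\theta_1t+\theta_2t^2))_{t\ge1}: A,B\in\mathbb R\bigr\}$$ and $$\bigl\{(A\cos(\theta_1't+\theta_2't^2)+B\sin(\theta_1't+\theta_2't^2))_{t\ge1}: A,B\in\mathbb R\bigr\}$$ are different. Assume that the true parameter $\xi^0=(A^0,B^0,\theta_1^0,\theta_2^0)$ is an interior point of $\Theta$, that $(A^0,B^0)\ne(0,0)$, and that $(\theta_1^0,\theta_2^0)$ is not one of the countably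 many points both of whose coordinates are rational multiples of $\pi$. For each $n$ let $\widetilde\theta_n=(\widetilde\theta_{1},\widetilde\theta_{2})$ be a point of $T$ that maximizes $$I_n(\theta)=\frac2n\Bigl|\sum_{t=1}^ny(t)e^{-i(\theta_1t+\theta_2t^2)}\Bigr|^2$$ over $\theta\in T$, and put $$\widetilde A_n=\frac2n\sum_{t=1}^ny(t)\cos(\widetilde\theta_{1}t+\widetilde\theta_{2}t^2),\qquad \widetilde B_n=\frac2n\sum_{t=1}^ny(t)\sin(\widetilde\theta_{1}t+\widetilde\theta_{2}t^2)$$ (it suffices that, almost surely, this holds for all sufficiently large $n$). Then the approximate least squares estimator $\widetilde\xi_n=(\widetilde A_n,\widetilde B_n,\widetilde\theta_{1},\widetilde\theta_{2})$ is strongly consistent: $\widetilde\xi_n\to\xi^0$ almost surely as $n\to\infty$. -/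

import Mathlib

open MeasureTheory ProbabilityTheory Filter Topology

noncomputable section

/-- The phase `θ₁ t + θ₂ t²` of a chirp with frequency `θ₁` and frequency rate `θ₂`. -/
def chirpPhase (θ : ℝ × ℝ) (t : ℕ) : ℝ :=
  θ.1 * (t : ℝ) + θ.2 * (t : ℝ) ^ 2

/-- The noiseless chirp signal `A cos(θ₁ t + θ₂ t²) + B sin(θ₁ t + θ₂ t²)`. -/
def chirpSignal (A B : ℝ) (θ : ℝ × ℝ) (t : ℕ) : ℝ :=
  A * Real.cos (chirpPhase θ t) + B * Real.sin (chirpPhase θ t)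

/-- The periodogram-like function
`I(θ) = (2 / n) |∑_{t=1}^n y(t) exp(-i (θ₁ t + θ₂ t²))|²` of the observations `y(1), …, y(n)`. -/
def chirpPeriodogram (y : ℕ → ℝ) (n : ℕ) (θ : ℝ × ℝ) : ℝ :=
  2 / (n : ℝ) *
    ‖∑ t ∈ Finset.Icc 1 n, (y t : ℂ) * Complex.exp (-(Complex.I * (chirpPhase θ t : ℂ)))‖ ^ 2

/-- The estimator of `A` computed from the frequency parameters `θ`. -/
def alseA (y : ℕ → ℝ) (n : ℕ) (θ : ℝ × ℝ) : ℝ :=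
  2 / (n : ℝ) * ∑ t ∈ Finset.Icc 1 n, y t * Real.cos (chirpPhase θ t)

/-- The estimator of `B` computed from the frequency parameters `θ`. -/
def alseB (y : ℕ → ℝ) (n : ℕ) (θ : ℝ × ℝ) : ℝ :=
  2 / (n : ℝ) * ∑ t ∈ Finset.Icc 1 n, y t * Real.sin (chirpPhase θ t)

/-- The pairs `(θ₁, θ₂)` that occur in the parameter space `Θ` of vectors `(A, B, θ₁, θ₂)`. -/
def frequencySpace (Θ : Set (ℝ × ℝ × ℝ × ℝ)) : Set (ℝ × ℝ) :=
  {θ | ∃ A B : ℝ, (A, B, θ.1, θ.2) ∈ Θ}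

/-- The family of all chirp signals, observed at `t = 1, 2, …`, with frequency parameters `θ`
and arbitrary amplitudes. The index `t` of the sequence stands for time `t + 1`. -/
def chirpFamily (θ : ℝ × ℝ) : Set (ℕ → ℝ) :=
  {s | ∃ A B : ℝ, ∀ t : ℕ, s t = chirpSignal A B θ (t + 1)}

/-- Frequency parameters in `T` are identifiable: distinct ones generate distinct families of
chirp signals. -/
def FrequencyIdentifiable (T : Set (ℝ × ℝ)) : Prop :=
  Set.InjOn chirpFamily T

/-- `(Ã, B̃, θ̃₁, θ̃₂)` is an approximate least squares estimate from `y(1), …, y(n)` over the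
parameter space `Θ`: `θ̃` maximizes the periodogram-like function over the admissible frequency
parameters, and the amplitudes are computed from `θ̃`. -/
def IsALSE (Θ : Set (ℝ × ℝ × ℝ × ℝ)) (y : ℕ → ℝ) (n : ℕ) (ξ : ℝ × ℝ × ℝ × ℝ) : Prop :=
  ξ.2.2 ∈ frequencySpace Θ ∧
  IsMaxOn (chirpPeriodogram y n) (frequencySpace Θ) ξ.2.2 ∧
  ξ.1 = alseA y n ξ.2.2 ∧
  ξ.2.1 = alseB y n ξ.2.2

end

/-! Put `C = (A⁰ - iB⁰)/2` and let `W n η` be the mean of `exp (i (η₁ t + η₂ t²))` over `t ≤ n`. The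
correlation of the data with the chirp `θ` is `C W(θ⁰ - θ) + C̄ W(-θ⁰ - θ) + noise`, and the
periodogram is `2n` times its squared modulus. At `θ⁰` this modulus tends to `‖C‖`, so at a
maximizer it is at least `‖C‖ - o(1)`.

Deterministic part. A Weyl sum of size at least `ε n` forces both frequencies to lie within `O(1/n)`
of rational multiples of `2π` with bounded denominator (`exists_near_rational_of_large_weyl_sum`).
If both Weyl means were large, subtracting would make both coordinates of `2θ⁰` such multiples,
which is excluded; so one of them is small (`eventually_weylMean_small_or_small`) and the other has
modulus near one. The latter forces its frequencies to lie near the lattice where the chirp is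
identically one, and the mean itself to be near one (`near_lattice_of_weylMean_near_one`). Since
`θ⁰` is interior, the candidate equivalent to `θ` modulo the lattice and sign is admissible, and
identifiability makes it equal to `θ` (`frequency_close_of_large_correlation`). Hence `θ → θ⁰`, the
correlation tends to `C`, and the amplitudes follow. Convergence of `θ` alone would not give them,
because `W` varies on scales shrinking with `n`; the closeness of `W` to one is what does.

Noise part. The correlation of the noise with every chirp must vanish uniformly in `θ`
(`ae_uniform_chirp_mean`). For bounded noise, two applications of van der Corput's inequality remove
the quadratic phase and leave products of four shifted noise values, free of `θ`. These are
orthogonal random variables, and countably many strong laws suffice. Truncation and the ordinary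
strong law handle integrable noise. -/

/-! ### Points of the unit circle and geometric sums. -/

/-- The point `exp (i x)` of the unit circle. -/
noncomputable def cis (x : ℝ) : ℂ := Complex.exp (x * Complex.I)

@[simp] lemma norm_cis (x : ℝ) : ‖cis x‖ = 1 := Complex.norm_exp_ofReal_mul_I x

@[simp] lemma cis_zero : cis 0 = 1 := by simp [cis]

lemma cis_add (x y : ℝ) : cis (x + y) = cis x * cis y := by
  simp [cis, add_mul, Complex.exp_add]

lemma conj_cis (x : ℝ) : (starRingEnd ℂ) (cis x) = cis (-x) := by
  simp [cis, ← Complex.exp_conj]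

lemma cis_nat_mul (n : ℕ) (x : ℝ) : cis (n * x) = cis x ^ n := by
  rw [cis, cis, ← Complex.exp_nat_mul]; push_cast; ring_nf

lemma cis_int_mul_two_pi (k : ℤ) : cis (2 * Real.pi * k) = 1 := by
  rw [cis, Complex.exp_eq_one_iff]; exact ⟨k, by push_cast; ring⟩

lemma cis_sub_two_pi (x : ℝ) (k : ℤ) : cis (x - 2 * Real.pi * k) = cis x := by
  have := cis_add (x - 2 * Real.pi * k) (2 * Real.pi * k)
  rw [cis_int_mul_two_pi, mul_one] at this
  rw [← this]; ring_nf

lemma norm_cis_sub_one_le (x : ℝ) : ‖cis x - 1‖ ≤ |x| := by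
  have := Real.norm_exp_I_mul_ofReal_sub_one_le (x := x)
  rwa [mul_comm] at this

lemma norm_cis_sub_cis (x y : ℝ) : ‖cis x - cis y‖ = ‖cis (x - y) - 1‖ := by
  have : cis x - cis y = cis y * (cis (x - y) - 1) := by
    rw [mul_sub, ← cis_add]; ring_nf
  rw [this, norm_mul, norm_cis, one_mul]

/-- The chord has length `2 |sin (x/2)|`, which Jordan's inequality bounds below. -/
lemma abs_le_norm_cis_sub_one {x : ℝ} (hx : |x| ≤ Real.pi) : |x| ≤ Real.pi / 2 * ‖cis x - 1‖ := by
  have h1 := Complex.norm_exp_I_mul_ofReal_sub_one x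
  have h2 : |x / 2| ≤ Real.pi / 2 := by rw [abs_div, abs_two]; linarith
  have h3 := Real.mul_abs_le_abs_sin h2
  rw [mul_comm] at h1
  rw [cis, h1, norm_mul, Real.norm_eq_abs, Real.norm_eq_abs, abs_two]
  rw [abs_div, abs_two] at h3
  have hp := Real.pi_pos
  calc |x| = Real.pi / 2 * (2 * (2 / Real.pi * (|x| / 2))) := by field_simp
    _ ≤ _ := by gcongr

lemma exists_abs_sub_two_pi_le (x : ℝ) :
    ∃ k : ℤ, |x - 2 * Real.pi * k| ≤ Real.pi / 2 * ‖cis x - 1‖ := by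
  refine ⟨round (x / (2 * Real.pi)), ?_⟩
  have hp := Real.pi_pos
  rw [← cis_sub_two_pi x (round (x / (2 * Real.pi)))]
  apply abs_le_norm_cis_sub_one
  have h := abs_sub_round (x / (2 * Real.pi))
  have : x - 2 * Real.pi * (round (x / (2 * Real.pi)) : ℤ)
      = 2 * Real.pi * (x / (2 * Real.pi) - round (x / (2 * Real.pi))) := by field_simp
  rw [this, abs_mul, abs_of_pos (by positivity : 0 < 2 * Real.pi)]
  nlinarith

lemma norm_geom_sum_cis_mul_le (x : ℝ) (n : ℕ) :
    ‖∑ t ∈ Finset.Icc 1 n, cis (t * x)‖ * ‖cis x - 1‖ ≤ 2 := by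
  rw [← norm_mul]
  have h : (∑ t ∈ Finset.Icc 1 n, cis (t * x)) * (cis x - 1) = cis x * (cis x ^ n - 1) := by
    induction n with
    | zero => simp
    | succ n ih =>
      rw [Finset.sum_Icc_succ_top (by omega), add_mul, ih, cis_nat_mul]; ring
  rw [h, norm_mul, norm_cis, one_mul]
  calc _ ≤ ‖cis x ^ n‖ + ‖(1 : ℂ)‖ := norm_sub_le _ _
    _ = 2 := by rw [norm_pow, norm_cis]; norm_num

/-! ### Van der Corput's inequality. -/

/-- Translating the summation range by `h` changes a sum of bounded terms by at most `2 h M`. -/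
lemma norm_sum_sub_sum_shift_le {g : ℕ → ℂ} {M : ℝ} (hg : ∀ t, ‖g t‖ ≤ M) (n h : ℕ) :
    ‖∑ t ∈ Finset.Icc 1 n, g t - ∑ t ∈ Finset.Icc 1 n, g (t + h)‖ ≤ 2 * h * M := by
  induction h with
  | zero => simp
  | succ h ih =>
    have key : ∑ t ∈ Finset.Icc 1 n, g (t + h) - ∑ t ∈ Finset.Icc 1 n, g (t + (h + 1))
        = g (1 + h) - g (n + 1 + h) := by
      clear ih
      induction n with
      | zero => simp
      | succ n ih =>
        rw [Finset.sum_Icc_succ_top (by omega), Finset.sum_Icc_succ_top (by omega)]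
        have : n + 1 + (h + 1) = n + 1 + 1 + h := by ring
        rw [this]
        linear_combination ih
    calc _ = ‖(∑ t ∈ Finset.Icc 1 n, g t - ∑ t ∈ Finset.Icc 1 n, g (t + h))
          + (g (1 + h) - g (n + 1 + h))‖ := by rw [← key]; congr 1; ring
      _ ≤ 2 * h * M + (M + M) := (norm_add_le _ _).trans
          (add_le_add ih ((norm_sub_le _ _).trans (add_le_add (hg _) (hg _))))
      _ = _ := by push_cast; ring

/-- Each of the `H` translates of the sum differs from it only by boundary terms. -/
lemma vanDerCorput_average {g : ℕ → ℂ} {M : ℝ} (hg : ∀ t, ‖g t‖ ≤ M) (n H : ℕ) :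
    H * ‖∑ t ∈ Finset.Icc 1 n, g t‖ ≤
      ‖∑ t ∈ Finset.Icc 1 n, ∑ h ∈ Finset.range H, g (t + h)‖ + 2 * H ^ 2 * M := by
  have hM : 0 ≤ M := (norm_nonneg _).trans (hg 0)
  have h1 : (H : ℂ) * ∑ t ∈ Finset.Icc 1 n, g t =
      ∑ t ∈ Finset.Icc 1 n, ∑ h ∈ Finset.range H, g (t + h) +
      ∑ h ∈ Finset.range H,
        (∑ t ∈ Finset.Icc 1 n, g t - ∑ t ∈ Finset.Icc 1 n, g (t + h)) := by
    rw [Finset.sum_sub_distrib, Finset.sum_comm]; simp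
  have h2 : (H : ℝ) * ‖∑ t ∈ Finset.Icc 1 n, g t‖ = ‖(H : ℂ) * ∑ t ∈ Finset.Icc 1 n, g t‖ := by
    simp
  rw [h2, h1]
  refine (norm_add_le _ _).trans (add_le_add le_rfl ?_)
  calc _ ≤ ∑ h ∈ Finset.range H, 2 * (H : ℝ) * M := norm_sum_le_of_le _ fun h hh =>
        (norm_sum_sub_sum_shift_le hg n h).trans (by
          have : (h : ℝ) ≤ H := by exact_mod_cast (Finset.mem_range.1 hh).le
          gcongr)
    _ = _ := by simp; ring

/-- Cauchy–Schwarz in `t`, after which the square is expanded and the sum over `t` moved inside. -/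
lemma vanDerCorput_square (g : ℕ → ℂ) (n H : ℕ) :
    ‖∑ t ∈ Finset.Icc 1 n, ∑ h ∈ Finset.range H, g (t + h)‖ ^ 2 ≤
      n * ∑ h ∈ Finset.range H, ∑ k ∈ Finset.range H,
        ‖∑ t ∈ Finset.Icc 1 n, g (t + h) * (starRingEnd ℂ) (g (t + k))‖ := by
  have h1 : ‖∑ t ∈ Finset.Icc 1 n, ∑ h ∈ Finset.range H, g (t + h)‖ ^ 2 ≤
      n * ∑ t ∈ Finset.Icc 1 n, ‖∑ h ∈ Finset.range H, g (t + h)‖ ^ 2 := by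
    calc _ ≤ (∑ t ∈ Finset.Icc 1 n, ‖∑ h ∈ Finset.range H, g (t + h)‖) ^ 2 := by
          gcongr; exact norm_sum_le _ _
      _ ≤ _ := by
          have := sq_sum_le_card_mul_sum_sq (s := Finset.Icc 1 n)
            (f := fun t => ‖∑ h ∈ Finset.range H, g (t + h)‖)
          simpa using this
  refine h1.trans (mul_le_mul_of_nonneg_left ?_ (Nat.cast_nonneg _))
  have h2 : ((∑ t ∈ Finset.Icc 1 n, ‖∑ h ∈ Finset.range H, g (t + h)‖ ^ 2 : ℝ) : ℂ) =
      ∑ h ∈ Finset.range H, ∑ k ∈ Finset.range H,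
        ∑ t ∈ Finset.Icc 1 n, g (t + h) * (starRingEnd ℂ) (g (t + k)) := by
    push_cast
    simp_rw [← Complex.mul_conj', map_sum, Finset.sum_mul_sum]
    rw [Finset.sum_comm]
    exact Finset.sum_congr rfl fun h _ => Finset.sum_comm
  calc _ = ‖((∑ t ∈ Finset.Icc 1 n, ‖∑ h ∈ Finset.range H, g (t + h)‖ ^ 2 : ℝ) : ℂ)‖ := by
        rw [Complex.norm_real, Real.norm_of_nonneg (by positivity)]
    _ ≤ _ := by
        rw [h2]
        exact norm_sum_le_of_le _ fun h _ => norm_sum_le _ _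

/-! ### Inverse theorem for quadratic Weyl sums. -/

/-- For a quadratic phase the correlation of the shifts `h` and `k` is a geometric sum of ratio `cis
(2β(h - k))`, so it can be large only when this ratio is close to one. Van der Corput's inequality
supplies many large correlations. -/
lemma exists_many_resonant_shifts {ε x β : ℝ} (hε : 0 < ε) {n H : ℕ} (hn : 0 < n) (hH : 0 < H)
    (hHn : 4 * (H : ℝ) ≤ ε * n)
    (hS : ε * n ≤ ‖∑ t ∈ Finset.Icc 1 n, cis (x * t + β * t ^ 2)‖) :
    ∃ G ⊆ Finset.range H, ε ^ 2 / 8 * H ≤ G.card ∧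
      ∀ h ∈ G, ∀ k ∈ G, ‖cis (2 * β * (h - k)) - 1‖ ≤ 32 / (ε ^ 2 * n) := by
  have hn' : (0 : ℝ) < n := by exact_mod_cast hn
  have hH' : (0 : ℝ) < H := by exact_mod_cast hH
  set g : ℕ → ℂ := fun t => cis (x * t + β * t ^ 2) with hg
  have hg1 : ∀ t, ‖g t‖ ≤ 1 := fun t => by simp [hg]
  set a : ℕ → ℕ → ℝ := fun h k =>
    ‖∑ t ∈ Finset.Icc 1 n, g (t + h) * (starRingEnd ℂ) (g (t + k))‖ with ha
  have ha_le : ∀ h k, a h k ≤ n := fun h k => by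
    calc a h k ≤ ∑ t ∈ Finset.Icc 1 n, (1 : ℝ) := norm_sum_le_of_le _ fun t _ => by
          simp [hg]
      _ = n := by simp
  have ha_geom : ∀ h k, a h k * ‖cis (2 * β * (h - k)) - 1‖ ≤ 2 := fun h k => by
    have : a h k = ‖∑ t ∈ Finset.Icc 1 n, cis (t * (2 * β * (h - k)))‖ := by
      have h1 : ∀ t : ℕ, g (t + h) * (starRingEnd ℂ) (g (t + k)) =
          cis (x * (h - k) + β * (h ^ 2 - k ^ 2)) * cis (t * (2 * β * (h - k))) := fun t => by
        simp only [hg]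
        rw [conj_cis, ← cis_add, ← cis_add]; push_cast; congr 1; ring
      rw [ha]
      simp only [h1]
      rw [← Finset.mul_sum, norm_mul, norm_cis, one_mul]
    rw [this]
    exact norm_geom_sum_cis_mul_le _ _
  -- The condition `4H ≤ ε n` lets the boundary term `2H²` take up at most half of `H ε n`.
  have hsq : H ^ 2 * (ε ^ 2 * n / 4) ≤
      ∑ k ∈ Finset.range H, ∑ h ∈ Finset.range H, a h k := by
    have h1 := vanDerCorput_average hg1 n H
    have h2 := vanDerCorput_square g n H
    set T := ‖∑ t ∈ Finset.Icc 1 n, ∑ h ∈ Finset.range H, g (t + h)‖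
    have h3 : H * (ε * n) / 2 ≤ T := by
      have : (H : ℝ) * (ε * n) ≤ H * ‖∑ t ∈ Finset.Icc 1 n, g t‖ := by gcongr
      nlinarith
    have h4 : (H * (ε * n) / 2) ^ 2 ≤ T ^ 2 := by gcongr
    rw [Finset.sum_comm]
    refine le_of_mul_le_mul_left (?_ : (n : ℝ) * _ ≤ n * _) hn'
    calc (n : ℝ) * (H ^ 2 * (ε ^ 2 * n / 4)) = (H * (ε * n) / 2) ^ 2 := by ring
      _ ≤ _ := h4.trans h2
  obtain ⟨k, -, hk⟩ : ∃ k ∈ Finset.range H,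
      H * (ε ^ 2 * n / 4) ≤ ∑ h ∈ Finset.range H, a h k := by
    apply Finset.exists_le_of_sum_le (Finset.nonempty_range_iff.2 hH.ne')
    refine le_trans (le_of_eq ?_) hsq
    simp; ring
  -- The threshold is half the average `ε² n / 4` guaranteed for the row of `k`. The base point `k`
  -- need not lie in the set: it is eliminated by the triangle inequality, which doubles `16` to
  -- `32`.
  refine ⟨(Finset.range H).filter fun h => ε ^ 2 * n / 8 ≤ a h k, Finset.filter_subset _ _, ?_, ?_⟩
  · set G := (Finset.range H).filter fun h => ε ^ 2 * n / 8 ≤ a h k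
    have h1 : ∑ h ∈ Finset.range H, a h k ≤ n * G.card + H * (ε ^ 2 * n / 8) := by
      rw [← Finset.sum_filter_add_sum_filter_not _ (fun h => ε ^ 2 * n / 8 ≤ a h k)]
      refine add_le_add ?_ ?_
      · calc _ ≤ ∑ h ∈ G, (n : ℝ) := Finset.sum_le_sum fun h _ => ha_le h k
          _ = _ := by simp; ring
      · calc _ ≤ ∑ h ∈ (Finset.range H).filter fun h => ¬ ε ^ 2 * n / 8 ≤ a h k,
                ε ^ 2 * (n : ℝ) / 8 := Finset.sum_le_sum fun h hh =>
                  (not_le.1 (Finset.mem_filter.1 hh).2).le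
          _ ≤ ∑ h ∈ Finset.range H, ε ^ 2 * (n : ℝ) / 8 :=
              Finset.sum_le_sum_of_subset_of_nonneg (Finset.filter_subset _ _)
                fun _ _ _ => by positivity
          _ = _ := by simp
    refine le_of_mul_le_mul_left (?_ : (n : ℝ) * _ ≤ n * _) hn'
    linarith
  · have key : ∀ h, ε ^ 2 * n / 8 ≤ a h k → ‖cis (2 * β * (h - k)) - 1‖ ≤ 16 / (ε ^ 2 * n) := by
      intro h hh
      rw [le_div_iff₀ (by positivity)]
      have := ha_geom h k
      have h2 := mul_le_mul_of_nonneg_right hh (norm_nonneg (cis (2 * β * (h - k)) - 1))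
      linarith
    intro h hh l hl
    have h1 := key h (Finset.mem_filter.1 hh).2
    have h2 := key l (Finset.mem_filter.1 hl).2
    have h3 : ‖cis (2 * β * (h - l)) - 1‖ = ‖cis (2 * β * (h - k)) - cis (2 * β * (l - k))‖ := by
      rw [norm_cis_sub_cis]; ring_nf
    rw [h3]
    calc _ = ‖(cis (2 * β * (h - k)) - 1) - (cis (2 * β * (l - k)) - 1)‖ := by ring_nf
      _ ≤ 16 / (ε ^ 2 * n) + 16 / (ε ^ 2 * n) := (norm_sub_le _ _).trans (add_le_add h1 h2)
      _ = _ := by ring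

/-- If many multiples of `γ` are close to `2πℤ`, then a bounded multiple is very close to it. -/
lemma exists_multiple_near_of_many_resonances {γ δ η : ℝ} {H J : ℕ} {G : Finset ℕ}
    (hJ : 2 ≤ δ * J) (hη : 0 ≤ η) (hηH : 2 * η * H ≤ 3)
    (hH : 2 * (J : ℝ) < δ * H) (hGH : G ⊆ Finset.range H) (hG : δ * H ≤ G.card)
    (hres : ∀ h ∈ G, ∀ k ∈ G, ‖cis (γ * (h - k)) - 1‖ ≤ η) :
    ∃ j : ℕ, 0 < j ∧ j ≤ J ∧ ∃ p : ℤ, |γ * j - 2 * Real.pi * p| * (δ * H) ≤ 4 * J ^ 2 * η := by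
  have hpi := Real.pi_gt_three
  have hpi4 := Real.pi_le_four
  have hJ0 : 0 < J := by
    rcases Nat.eq_zero_or_pos J with h | h
    · simp [h] at hJ; linarith
    · exact h
  have hJ' : (1 : ℝ) ≤ J := by exact_mod_cast hJ0
  have hsym : ∀ h ∈ G, ∀ k ∈ G, k < h → ‖cis (γ * ((h - k : ℕ) : ℝ)) - 1‖ ≤ η := by
    intro h hh k hk hkh
    rw [Nat.cast_sub hkh.le]; exact hres h hh k hk
  obtain ⟨j, hj0, hjJ, hj⟩ : ∃ j : ℕ, 0 < j ∧ j ≤ J ∧ ‖cis (γ * j) - 1‖ ≤ η := by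
    -- Pigeonhole: there are more resonant shifts than blocks of length `J`, so two of them differ
    -- by at most `J`.
    have hcard : (Finset.range (H / J + 1)).card < G.card := by
      rw [Finset.card_range]
      have h1 : ((H / J : ℕ) : ℝ) ≤ H / J := Nat.cast_div_le
      have h2 : (H : ℝ) / J ≤ δ * H / 2 := by
        rw [div_le_div_iff₀ (by positivity) (by norm_num)]
        nlinarith [Nat.cast_nonneg (α := ℝ) H]
      have : ((H / J + 1 : ℕ) : ℝ) < G.card := by push_cast; linarith
      exact_mod_cast this
    obtain ⟨h, hh, k, hk, hne, heq⟩ := Finset.exists_ne_map_eq_of_card_lt_of_maps_to hcard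
      (f := fun h => h / J) (fun h hh => by
        have := Finset.mem_range.1 (hGH hh)
        exact Finset.mem_coe.2 (Finset.mem_range.2 (Nat.lt_succ_of_le (Nat.div_le_div_right this.le))))
    have aux : ∀ h k : ℕ, k < h → h / J = k / J → h - k ≤ J := by
      intro h k hkh he
      have h1 := Nat.div_add_mod h J
      have h2 := Nat.div_add_mod k J
      have h3 := Nat.mod_lt h hJ0
      rw [he] at h1
      omega
    rcases lt_or_gt_of_ne hne with hlt | hlt
    · exact ⟨k - h, by omega, aux k h hlt heq.symm, hsym k hk h hh hlt⟩
    · exact ⟨h - k, by omega, aux h k hlt heq, hsym h hh k hk hlt⟩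
  obtain ⟨p, hp⟩ := exists_abs_sub_two_pi_le (γ * j)
  have hp2 : |γ * j - 2 * Real.pi * p| ≤ 2 * η := hp.trans (by
    have := norm_nonneg (cis (γ * j) - 1)
    nlinarith)
  refine ⟨j, hj0, hjJ, p, ?_⟩
  set τ := γ * j - 2 * Real.pi * p with hτ
  have hj' : (1 : ℝ) ≤ j := by exact_mod_cast hj0
  have hjJ' : (j : ℝ) ≤ J := by exact_mod_cast hjJ
  -- A crowded residue class mod `j` contains two resonant shifts at a distance `j * l` with `l` of
  -- order `H / j²`. Resonance at that distance improves the bound on `τ` by the factor `l`.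
  obtain ⟨r, -, hr⟩ : ∃ r ∈ Finset.range j, δ * H / j ≤ ((G.filter fun h => h % j = r).card : ℝ) := by
    apply Finset.exists_le_card_fiber_of_nsmul_le_card_of_maps_to
      (fun h _ => Finset.mem_range.2 (Nat.mod_lt h hj0)) (Finset.nonempty_range_iff.2 hj0.ne')
    rw [Finset.card_range, nsmul_eq_mul, mul_div_cancel₀ _ (by positivity)]
    exact hG
  set F := G.filter fun h => h % j = r with hF
  have hδHj : 2 ≤ δ * H / j := by
    rw [le_div_iff₀ (by positivity)]; linarith
  have hFne : F.Nonempty := by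
    rw [← Finset.card_pos]
    have : (0 : ℝ) < F.card := by linarith
    exact_mod_cast this
  set k₁ := F.min' hFne
  set k₂ := F.max' hFne
  have hk₁ : k₁ ∈ F := F.min'_mem hFne
  have hk₂ : k₂ ∈ F := F.max'_mem hFne
  have hle : k₁ ≤ k₂ := F.min'_le _ hk₂
  have hspread : F.card ≤ k₂ - k₁ + 1 := by
    have : F ⊆ Finset.Icc k₁ k₂ := fun h hh => Finset.mem_Icc.2 ⟨F.min'_le _ hh, F.le_max' _ hh⟩
    have := Finset.card_le_card this
    rw [Nat.card_Icc] at this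
    omega
  obtain ⟨l, hl⟩ : j ∣ k₂ - k₁ :=
    (Nat.modEq_iff_dvd' hle).1 ((Finset.mem_filter.1 hk₁).2.trans (Finset.mem_filter.1 hk₂).2.symm)
  have hlj : δ * H / j ≤ 2 * (j * l) := by
    have h1 : (F.card : ℝ) ≤ j * l + 1 := by rw [hl] at hspread; exact_mod_cast hspread
    linarith
  have hl0 : (0 : ℝ) < l := by
    by_contra h
    have : (l : ℝ) = 0 := le_antisymm (not_lt.1 h) (Nat.cast_nonneg _)
    rw [this] at hlj; linarith
  have hljH : (j * l : ℝ) ≤ H := by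
    have := Finset.mem_range.1 (hGH (Finset.mem_filter.1 hk₂).1)
    have h2 : j * l ≤ H := by omega
    exact_mod_cast h2
  have hcis : ‖cis (l * τ) - 1‖ ≤ η := by
    have h1 := hres k₂ (Finset.mem_filter.1 hk₂).1 k₁ (Finset.mem_filter.1 hk₁).1
    rw [← Nat.cast_sub hle, hl] at h1
    have h2 : l * τ = γ * ((j * l : ℕ) : ℝ) - 2 * Real.pi * ((p * l : ℤ) : ℝ) := by
      rw [hτ]; push_cast; ring
    rwa [h2, cis_sub_two_pi]
  -- Here `l |τ| ≤ 2ηH ≤ 3 < π`, so there is no wrap-around and the chord controls `l * τ` itself.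
  have hlτ : |l * τ| ≤ Real.pi := by
    rw [abs_mul, abs_of_pos hl0]
    have : (l : ℝ) ≤ H := by nlinarith
    nlinarith [abs_nonneg τ]
  have hlτ2 : l * |τ| ≤ 2 * η := by
    have h1 := abs_le_norm_cis_sub_one hlτ
    rw [abs_mul, abs_of_pos hl0] at h1
    have := norm_nonneg (cis (l * τ) - 1)
    nlinarith
  have h1 : δ * H ≤ 2 * j ^ 2 * l := by
    rw [div_le_iff₀ (by positivity)] at hlj; linarith
  calc |τ| * (δ * H) ≤ |τ| * (2 * j ^ 2 * l) := by gcongr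
    _ = 2 * j ^ 2 * (l * |τ|) := by ring
    _ ≤ 2 * J ^ 2 * (2 * η) := by gcongr
    _ = _ := by ring

/-- Translation by `2j` alters the sum little, yet also nearly multiplies it by `cis w`, since the
cross term `4βjt` is almost a multiple of `2π`. As the sum is large, `cis w` must be near one. -/
lemma linear_frequency_near_of_quadratic_near {ε x β : ℝ} (hε : 0 < ε) {n j : ℕ} (hn : 0 < n)
    (p : ℤ) (hS : ε * n ≤ ‖∑ t ∈ Finset.Icc 1 n, cis (x * t + β * t ^ 2)‖) :
    ∃ a : ℤ, |((2 * j : ℕ) : ℝ) * x - 2 * Real.pi * a| ≤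
      2 * ((4 * j + 2 * n ^ 2 * |2 * β * j - 2 * Real.pi * p|) / (ε * n)) +
      2 * j * |2 * β * j - 2 * Real.pi * p| := by
  have hpi4 := Real.pi_le_four
  have hn' : (0 : ℝ) < n := by exact_mod_cast hn
  set τ := 2 * β * j - 2 * Real.pi * p with hτ
  set S := ∑ t ∈ Finset.Icc 1 n, cis (x * t + β * t ^ 2)
  set w := 2 * j * x + 2 * j * τ with hw
  have hshift : ∀ t : ℕ, cis (x * ((t + 2 * j : ℕ) : ℝ) + β * ((t + 2 * j : ℕ) : ℝ) ^ 2) =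
      cis w * cis (x * t + β * t ^ 2) * cis (2 * t * τ) := by
    intro t
    rw [← cis_add, ← cis_add, ← cis_sub_two_pi _ (p * (2 * t + 2 * j))]
    congr 1
    rw [hw, hτ]; push_cast; ring
  have h1 : ‖S - ∑ t ∈ Finset.Icc 1 n,
      cis (x * ((t + 2 * j : ℕ) : ℝ) + β * ((t + 2 * j : ℕ) : ℝ) ^ 2)‖ ≤ 4 * j := by
    have := norm_sum_sub_sum_shift_le (g := fun t : ℕ => cis (x * t + β * t ^ 2)) (M := 1)
      (fun t => by simp) n (2 * j)
    push_cast at this ⊢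
    linarith
  have h2 : ‖∑ t ∈ Finset.Icc 1 n,
      cis (x * ((t + 2 * j : ℕ) : ℝ) + β * ((t + 2 * j : ℕ) : ℝ) ^ 2) - cis w * S‖ ≤
      2 * n ^ 2 * |τ| := by
    rw [Finset.mul_sum, ← Finset.sum_sub_distrib]
    calc _ ≤ ∑ t ∈ Finset.Icc 1 n, 2 * (n : ℝ) * |τ| := norm_sum_le_of_le _ fun t ht => by
          have h3 : (t : ℝ) ≤ n := by exact_mod_cast (Finset.mem_Icc.1 ht).2
          rw [hshift, ← mul_sub_one, norm_mul, norm_mul, norm_cis, norm_cis, one_mul, one_mul]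
          refine (norm_cis_sub_one_le _).trans ?_
          rw [abs_mul, abs_of_nonneg (by positivity : (0 : ℝ) ≤ 2 * t)]
          gcongr
      _ = _ := by simp; ring
  have h3 : ‖S‖ * ‖cis w - 1‖ ≤ 4 * j + 2 * n ^ 2 * |τ| := by
    rw [← norm_mul, ← norm_neg]
    refine le_trans (le_of_eq ?_) ((norm_add_le _ _).trans (add_le_add h1 h2))
    congr 1; ring
  have h4 : ‖cis w - 1‖ ≤ (4 * j + 2 * n ^ 2 * |τ|) / (ε * n) := by
    rw [le_div_iff₀ (by positivity), mul_comm]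
    exact (mul_le_mul_of_nonneg_right hS (norm_nonneg _)).trans h3
  obtain ⟨a, ha⟩ := exists_abs_sub_two_pi_le w
  refine ⟨a, ?_⟩
  have h5 : ((2 * j : ℕ) : ℝ) * x - 2 * Real.pi * a = (w - 2 * Real.pi * a) - 2 * j * τ := by
    rw [hw]; push_cast; ring
  rw [h5]
  refine (abs_sub _ _).trans (add_le_add (ha.trans ?_) ?_)
  · exact mul_le_mul (by linarith) h4 (norm_nonneg _) (by norm_num)
  · rw [abs_mul, abs_of_nonneg (by positivity : (0 : ℝ) ≤ 2 * j)]

/-- Inverse theorem for quadratic Weyl sums: if the sum is not small, then both frequencies are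
close to rational multiples of `2π` with a bounded common denominator. -/
theorem exists_near_rational_of_large_weyl_sum {ε : ℝ} (hε : 0 < ε) (hε1 : ε ≤ 1) :
    ∃ (Q N : ℕ) (C : ℝ), ∀ n : ℕ, N ≤ n → ∀ x β : ℝ,
      ε * n ≤ ‖∑ t ∈ Finset.Icc 1 n, cis (x * t + β * t ^ 2)‖ →
      ∃ q : ℕ, 0 < q ∧ q ≤ Q ∧ (∃ a : ℤ, |q * x - 2 * Real.pi * a| ≤ C / n) ∧
        ∃ b : ℤ, |q * β - 2 * Real.pi * b| ≤ C / n := by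
  -- With density `δ = ε²/8` this is the requirement `2 ≤ δ J`.
  obtain ⟨J, hJ⟩ := exists_nat_ge (2 / (ε ^ 2 / 8))
  obtain ⟨N, hN⟩ := exists_nat_gt (64 / ε ^ 2 + 128 * J / (ε ^ 2 / 8 * ε ^ 2))
  set D : ℝ := 4 * J ^ 2 * 32 * 64 / (ε ^ 2 / 8 * ε ^ 2 * ε ^ 2) with hD
  have hD0 : 0 ≤ D := by positivity
  refine ⟨2 * J, N, 2 * ((4 * J + 2 * D) / ε) + 2 * J * D + D, fun n hn x β hS => ?_⟩
  have hnN : (N : ℝ) ≤ n := by exact_mod_cast hn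
  have hJ0 : (0 : ℝ) ≤ J := Nat.cast_nonneg _
  have hn1 : 64 / ε ^ 2 < n := by
    have : (0 : ℝ) ≤ 128 * J / (ε ^ 2 / 8 * ε ^ 2) := by positivity
    linarith
  have hn2 : 128 * J / (ε ^ 2 / 8 * ε ^ 2) < n := by
    have : (0 : ℝ) ≤ 64 / ε ^ 2 := by positivity
    linarith
  have hn0 : (0 : ℝ) < n := lt_of_le_of_lt (by positivity) hn1
  have hn0' : 0 < n := by exact_mod_cast hn0
  have hn1' : (1 : ℝ) ≤ n := by exact_mod_cast hn0'
  rw [div_lt_iff₀ (by positivity)] at hn1 hn2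
  -- This choice gives both `4H ≤ ε n` and `2ηH ≤ 2` for `η = 32 / (ε² n)`, while `H` stays of order
  -- `n`, so that `τ = O(1/n²)`.
  set H := ⌊ε ^ 2 * n / 32⌋₊
  have hHle : (H : ℝ) ≤ ε ^ 2 * n / 32 := Nat.floor_le (by positivity)
  have hHge : ε ^ 2 * n / 64 ≤ H := by
    have := Nat.lt_floor_add_one (ε ^ 2 * (n : ℝ) / 32)
    have h2 : ε ^ 2 * (n : ℝ) / 32 < H + 1 := this
    linarith
  have hH0 : (0 : ℝ) < H := lt_of_lt_of_le (by positivity) hHge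
  have hεn : ε ^ 2 * n ≤ ε * n := by
    gcongr; nlinarith
  obtain ⟨G, hGH, hG, hres⟩ := exists_many_resonant_shifts (H := H) hε hn0' (by exact_mod_cast hH0)
    (by linarith) hS
  rw [div_le_iff₀ (by positivity)] at hJ
  obtain ⟨j, hj0, hjJ, p, hp⟩ := exists_multiple_near_of_many_resonances (γ := 2 * β) (J := J)
    (by linarith) (by positivity)
    (by
      rw [mul_div_assoc', div_mul_eq_mul_div, div_le_iff₀ (by positivity)]
      linarith)
    (by nlinarith [sq_nonneg ε]) hGH hG hres
  obtain ⟨a, ha⟩ := linear_frequency_near_of_quadratic_near (j := j) hε hn0' p hS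
  set τ := |2 * β * j - 2 * Real.pi * p| with hτ
  have hτ0 : 0 ≤ τ := abs_nonneg _
  have hτD : τ ≤ D / n ^ 2 := by
    have h1 : τ * (ε ^ 2 / 8 * (ε ^ 2 * n / 64)) ≤ 4 * J ^ 2 * (32 / (ε ^ 2 * n)) :=
      le_trans (by gcongr) hp
    replace h1 := (le_div_iff₀ (by positivity)).1 (h1.trans_eq (mul_div_assoc _ _ _).symm)
    rw [hD, div_div, le_div_iff₀ (by positivity)]
    nlinarith
  have hτD2 : n ^ 2 * τ ≤ D := by
    rw [le_div_iff₀ (by positivity)] at hτD; linarith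
  have hτD1 : τ ≤ D / n := hτD.trans (by
    apply div_le_div_of_nonneg_left hD0 hn0; nlinarith)
  have hjJ' : (j : ℝ) ≤ J := by exact_mod_cast hjJ
  have hC1 : D / n ≤ (2 * ((4 * J + 2 * D) / ε) + 2 * J * D + D) / n := by
    gcongr
    have : 0 ≤ 2 * ((4 * J + 2 * D) / ε) + 2 * J * D := by positivity
    linarith
  refine ⟨2 * j, by omega, by omega, ⟨a, ha.trans ?_⟩, p, ?_⟩
  · calc _ ≤ 2 * ((4 * J + 2 * D) / (ε * n)) + 2 * J * (D / n) := by
          have : 2 * (n : ℝ) ^ 2 * τ ≤ 2 * D := by linarith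
          gcongr
      _ = (2 * ((4 * J + 2 * D) / ε) + 2 * J * D) / n := by field_simp
      _ ≤ _ := by refine div_le_div_of_nonneg_right ?_ hn0.le; linarith
  · refine le_trans (le_of_eq ?_) (hτD1.trans hC1)
    rw [hτ]; push_cast; ring_nf

/-! ### Weyl means and the separation of `θ⁰ - θ` from `-θ⁰ - θ`. -/

/-- The average of `exp (i (η₁ t + η₂ t²))` over `t = 1, …, n`. -/
noncomputable def weylMean (n : ℕ) (η : ℝ × ℝ) : ℂ :=
  (n : ℂ)⁻¹ * ∑ t ∈ Finset.Icc 1 n, cis (chirpPhase η t)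

lemma norm_weylMean (n : ℕ) (η : ℝ × ℝ) :
    ‖weylMean n η‖ = (n : ℝ)⁻¹ * ‖∑ t ∈ Finset.Icc 1 n, cis (chirpPhase η t)‖ := by
  simp [weylMean]

lemma chirpPhase_neg (η : ℝ × ℝ) (t : ℕ) : chirpPhase (-η) t = -chirpPhase η t := by
  simp [chirpPhase]; ring

lemma chirpPhase_sub (η θ : ℝ × ℝ) (t : ℕ) :
    chirpPhase (η - θ) t = chirpPhase η t - chirpPhase θ t := by
  simp [chirpPhase]; ring

lemma conj_weylMean (n : ℕ) (η : ℝ × ℝ) :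
    (starRingEnd ℂ) (weylMean n η) = weylMean n (-η) := by
  simp [weylMean, conj_cis, chirpPhase_neg]

lemma norm_weylMean_neg (n : ℕ) (η : ℝ × ℝ) : ‖weylMean n (-η)‖ = ‖weylMean n η‖ := by
  rw [← conj_weylMean, RCLike.norm_conj]

lemma exists_int_of_cis_eq_one {x : ℝ} (h : cis x = 1) : ∃ k : ℤ, x = 2 * Real.pi * k := by
  obtain ⟨k, hk⟩ := exists_abs_sub_two_pi_le x
  rw [h, sub_self, norm_zero, mul_zero] at hk
  exact ⟨k, by linarith [abs_nonpos_iff.1 hk]⟩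

lemma norm_cis_sub_one_le_of_near {x r : ℝ} {k : ℤ} (h : |x - 2 * Real.pi * k| ≤ r) :
    ‖cis x - 1‖ ≤ r := by
  rw [← cis_sub_two_pi x k]
  exact (norm_cis_sub_one_le _).trans h

/-- Correlations with two opposite chirps whose frequencies are not rational multiples of `π`
cannot both be large. -/
theorem eventually_weylMean_small_or_small {θ₀ : ℝ × ℝ}
    (hθ : ¬ ((∃ r : ℚ, θ₀.1 = r * Real.pi) ∧ (∃ s : ℚ, θ₀.2 = s * Real.pi)))
    {ε : ℝ} (hε : 0 < ε) :
    ∀ᶠ n : ℕ in atTop, ∀ θ : ℝ × ℝ,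
      ‖weylMean n (θ₀ - θ)‖ < ε ∨ ‖weylMean n (-θ₀ - θ)‖ < ε := by
  wlog hε1 : ε ≤ 1 generalizing ε
  · filter_upwards [this one_pos le_rfl] with n hn θ
    exact (hn θ).imp (fun h => h.trans (not_le.1 hε1)) (fun h => h.trans (not_le.1 hε1))
  obtain ⟨Q, N, C, hQ⟩ := exists_near_rational_of_large_weyl_sum hε hε1
  -- For fixed `m`, infinitely many failures would force `cis (2mθ₀)` to equal one in both
  -- coordinates. Only the finitely many products `m = q q' ≤ Q²` occur, which makes the threshold
  -- uniform in `θ`.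
  have hsep : ∀ m : ℕ, 0 < m → ∀ᶠ n : ℕ in atTop,
      ¬ (‖cis (m * (2 * θ₀.1)) - 1‖ ≤ 2 * Q * (C / n) ∧
        ‖cis (m * (2 * θ₀.2)) - 1‖ ≤ 2 * Q * (C / n)) := by
    intro m hm
    by_contra hcon
    rw [not_eventually] at hcon
    have hm' : (m : ℝ) ≠ 0 := by exact_mod_cast hm.ne'
    have hlim : Tendsto (fun n : ℕ => 2 * Q * (C / (n : ℝ))) atTop (𝓝 0) := by
      simpa using (tendsto_const_div_atTop_nhds_zero_nat C).const_mul (2 * (Q : ℝ))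
    have hzero : ∀ x : ℝ, (∃ᶠ n : ℕ in atTop, ‖cis (m * (2 * x)) - 1‖ ≤ 2 * Q * (C / n)) →
        ∃ r : ℚ, x = r * Real.pi := by
      intro x hx
      have h0 : cis (m * (2 * x)) = 1 := by
        have : ‖cis (m * (2 * x)) - 1‖ ≤ 0 := ge_of_tendsto_of_frequently hlim hx
        exact sub_eq_zero.1 (norm_le_zero_iff.1 this)
      obtain ⟨k, hk⟩ := exists_int_of_cis_eq_one h0
      refine ⟨(k : ℚ) / m, ?_⟩
      push_cast
      field_simp
      linarith
    exact hθ ⟨hzero _ (hcon.mono fun n h => (not_not.1 h).1),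
      hzero _ (hcon.mono fun n h => (not_not.1 h).2)⟩
  have hall : ∀ᶠ n : ℕ in atTop, ∀ m ∈ Finset.Icc 1 (Q * Q),
      ¬ (‖cis (m * (2 * θ₀.1)) - 1‖ ≤ 2 * Q * (C / n) ∧
        ‖cis (m * (2 * θ₀.2)) - 1‖ ≤ 2 * Q * (C / n)) :=
    (Finset.eventually_all _).2 fun m hm => hsep m (Finset.mem_Icc.1 hm).1
  filter_upwards [hall, eventually_ge_atTop N, eventually_gt_atTop 0] with n hn hnN hn0 θ
  by_contra! hcon
  have hn0' : (0 : ℝ) < n := by exact_mod_cast hn0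
  have hlarge : ∀ η : ℝ × ℝ, ε ≤ ‖weylMean n η‖ →
      ε * n ≤ ‖∑ t ∈ Finset.Icc 1 n, cis (η.1 * t + η.2 * t ^ 2)‖ := by
    intro η h
    rw [norm_weylMean, inv_mul_eq_div, le_div_iff₀ hn0'] at h
    exact h
  obtain ⟨q, hq0, hqQ, ⟨a, ha⟩, b, hb⟩ := hQ n hnN _ _ (hlarge _ hcon.1)
  obtain ⟨q', hq0', hqQ', ⟨a', ha'⟩, b', hb'⟩ := hQ n hnN _ _ (hlarge _ hcon.2)
  have hC : 0 ≤ C / n := (abs_nonneg _).trans ha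
  have comb : ∀ (x y z : ℝ) (a a' : ℤ), x - y = 2 * z → |q * x - 2 * Real.pi * a| ≤ C / n →
      |q' * y - 2 * Real.pi * a'| ≤ C / n →
      ‖cis (((q * q' : ℕ) : ℝ) * (2 * z)) - 1‖ ≤ 2 * Q * (C / n) := by
    intro x y z a a' hz h h'
    apply norm_cis_sub_one_le_of_near (k := q' * a - q * a')
    have : ((q * q' : ℕ) : ℝ) * (2 * z) - 2 * Real.pi * ((q' * a - q * a' : ℤ) : ℝ) =
        q' * (q * x - 2 * Real.pi * a) - q * (q' * y - 2 * Real.pi * a') := by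
      rw [← hz]; push_cast; ring
    rw [this]
    have hq1 : (q : ℝ) ≤ Q := by exact_mod_cast hqQ
    have hq2 : (q' : ℝ) ≤ Q := by exact_mod_cast hqQ'
    calc _ ≤ |q' * (q * x - 2 * Real.pi * a)| + |q * (q' * y - 2 * Real.pi * a')| := abs_sub _ _
      _ = q' * |q * x - 2 * Real.pi * a| + q * |q' * y - 2 * Real.pi * a'| := by
          rw [abs_mul, abs_mul, Nat.abs_cast, Nat.abs_cast]
      _ ≤ Q * (C / n) + Q * (C / n) := by gcongr
      _ = _ := by ring
  refine hn (q * q') (Finset.mem_Icc.2 ⟨Nat.mul_pos hq0 hq0', Nat.mul_le_mul hqQ hqQ'⟩) ⟨?_, ?_⟩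
  · exact comb _ _ _ a a' (by simp; ring) ha ha'
  · exact comb _ _ _ b b' (by simp; ring) hb hb'

/-! ### Weyl means of modulus close to one. -/

/-- A continuity argument in `m`: passing from `m` to `m + 1` multiplies the bound `2κ` by at most
`4`, giving at most `2 < π`. The same multiple `k` therefore stays the nearest one, and the chord
estimate restores `2κ`. -/
lemma exists_near_of_cis_mul_pow_near {c κ : ℝ} {M p : ℕ} (hp : p ≤ 2) (hM : 0 < M)
    (hκ : κ ≤ 1 / 4) (h : ∀ m : ℕ, 0 < m → m ≤ M → ‖cis (c * m ^ p) - 1‖ ≤ κ) :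
    ∃ k : ℤ, |c - 2 * Real.pi * k| * M ^ p ≤ 2 * κ := by
  have hpi := Real.pi_gt_three
  have hpi4 := Real.pi_le_four
  obtain ⟨k, hk⟩ := exists_abs_sub_two_pi_le c
  refine ⟨k, ?_⟩
  have hκ0 : 0 ≤ κ := (norm_nonneg _).trans (h 1 one_pos hM)
  have key : ∀ m : ℕ, 0 < m → m ≤ M → |c - 2 * Real.pi * k| * m ^ p ≤ 2 * κ := by
    intro m hm
    induction m, hm using Nat.le_induction with
    | base =>
      intro _
      have h1 := h 1 one_pos hM
      simp only [Nat.cast_one, one_pow, mul_one] at h1 ⊢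
      nlinarith [norm_nonneg (cis c - 1)]
    | succ m hm ih =>
      intro hmM
      have ih' := ih (by omega)
      have hm1 : (1 : ℝ) ≤ m := by exact_mod_cast hm
      have hgrow : ((m : ℝ) + 1) ^ p ≤ 4 * m ^ p := by
        calc ((m : ℝ) + 1) ^ p ≤ (2 * m) ^ p := by gcongr; linarith
          _ = 2 ^ p * m ^ p := mul_pow _ _ _
          _ ≤ 2 ^ 2 * m ^ p := by
            gcongr
            norm_num
          _ = _ := by norm_num
      have hsmall : |(c - 2 * Real.pi * k) * ((m + 1 : ℕ) : ℝ) ^ p| ≤ Real.pi := by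
        rw [abs_mul, abs_of_nonneg (by positivity : (0 : ℝ) ≤ ((m + 1 : ℕ) : ℝ) ^ p)]
        push_cast
        nlinarith [mul_le_mul_of_nonneg_left hgrow (abs_nonneg (c - 2 * Real.pi * k))]
      have h1 := abs_le_norm_cis_sub_one hsmall
      have h2 : (c - 2 * Real.pi * k) * ((m + 1 : ℕ) : ℝ) ^ p =
          c * ((m + 1 : ℕ) : ℝ) ^ p - 2 * Real.pi * ((k * (m + 1) ^ p : ℤ) : ℝ) := by
        push_cast; ring
      have h3 := h (m + 1) (by omega) hmM
      rw [abs_mul, abs_of_nonneg (by positivity : (0 : ℝ) ≤ ((m + 1 : ℕ) : ℝ) ^ p), h2,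
        cis_sub_two_pi] at h1
      nlinarith [norm_nonneg (cis (c * ((m + 1 : ℕ) : ℝ) ^ p) - 1)]
  exact key M hM le_rfl

/-- If `n` unimodular numbers have a mean `D` of modulus close to one, then for every moderate `m`
there are three of them in arithmetic progression of step `m` that are close to `D`. -/
lemma exists_progression_near_mean {z : ℕ → ℂ} (hz : ∀ t, ‖z t‖ = 1) {n m : ℕ} (hn : 0 < n)
    (hm : 4 * m ≤ n) {κ : ℝ} (hκ : 0 < κ) {D : ℂ} (hD : n * D = ∑ t ∈ Finset.Icc 1 n, z t)
    (hD1 : 1 - κ ^ 2 / 16 ≤ ‖D‖) :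
    ∃ t, t + m ≤ n ∧ ‖z t - D‖ ≤ κ ∧ ‖z (t + m) - D‖ ≤ κ ∧ ‖z (t + 2 * m) - D‖ ≤ κ := by
  have hn' : (0 : ℝ) < n := by exact_mod_cast hn
  -- Variance identity; by Chebyshev at most `n/8` of the points are farther than `κ` from `D`.
  have hvar : ∑ t ∈ Finset.Icc 1 n, ‖z t - D‖ ^ 2 = n * (1 - ‖D‖ ^ 2) := by
    have h1 : ∀ t, ‖z t - D‖ ^ 2 = 1 + ‖D‖ ^ 2 - 2 * (z t * (starRingEnd ℂ) D).re := by
      intro t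
      have := Complex.normSq_sub (z t) D
      rw [← Complex.sq_norm, ← Complex.sq_norm, ← Complex.sq_norm, hz] at this
      rw [this]; ring
    simp_rw [h1]
    rw [Finset.sum_sub_distrib, ← Finset.mul_sum, ← Complex.re_sum, ← Finset.sum_mul, ← hD,
      mul_assoc, Complex.mul_conj']
    have : ((n : ℂ) * (‖D‖ : ℂ) ^ 2).re = n * ‖D‖ ^ 2 := by
      have : ((n : ℂ) * (‖D‖ : ℂ) ^ 2) = ((n * ‖D‖ ^ 2 : ℝ) : ℂ) := by push_cast; ring
      rw [this, Complex.ofReal_re]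
    rw [this]; simp; ring
  set B := (Finset.Icc 1 n).filter fun t => κ < ‖z t - D‖ with hB
  have hBcard : (B.card : ℝ) ≤ n / 8 := by
    have h1 : B.card * κ ^ 2 ≤ ∑ t ∈ Finset.Icc 1 n, ‖z t - D‖ ^ 2 := by
      calc (B.card : ℝ) * κ ^ 2 = ∑ t ∈ B, κ ^ 2 := by simp
        _ ≤ ∑ t ∈ B, ‖z t - D‖ ^ 2 := Finset.sum_le_sum fun t ht => by
            have := (Finset.mem_filter.1 ht).2
            gcongr
        _ ≤ _ := Finset.sum_le_sum_of_subset_of_nonneg (Finset.filter_subset _ _)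
            fun _ _ _ => by positivity
    have hDle : 1 - ‖D‖ ^ 2 ≤ κ ^ 2 / 8 := by
      nlinarith [sq_nonneg (‖D‖ - 1)]
    have h2 : (B.card : ℝ) * κ ^ 2 ≤ n / 8 * κ ^ 2 := by
      rw [hvar] at h1
      nlinarith
    exact le_of_mul_le_mul_right h2 (by positivity)
  have hBcard' : 8 * B.card ≤ n := by
    have : (8 * B.card : ℝ) ≤ n := by linarith
    exact_mod_cast this
  by_contra! hcon
  set I := Finset.Icc 1 (n - 2 * m) with hI
  -- The three bad conditions exclude at most `3n/8` starting points, fewer than the `n - 2m ≥ n/2`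
  -- available.
  have hcover : I ⊆ (I.filter fun t => t ∈ B) ∪
      ((I.filter fun t => t + m ∈ B) ∪ I.filter fun t => t + 2 * m ∈ B) := by
    intro t ht
    have ht' := Finset.mem_Icc.1 ht
    have hmem : ∀ s, s ≤ 2 * m → κ < ‖z (t + s) - D‖ → t + s ∈ B := fun s hs h =>
      Finset.mem_filter.2 ⟨Finset.mem_Icc.2 (by omega), h⟩
    simp only [Finset.mem_union, Finset.mem_filter]
    by_cases h1 : ‖z t - D‖ ≤ κ
    · by_cases h2 : ‖z (t + m) - D‖ ≤ κ
      · exact Or.inr (Or.inr ⟨ht, hmem _ le_rfl (hcon t (by omega) h1 h2)⟩)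
      · exact Or.inr (Or.inl ⟨ht, hmem _ (by omega) (not_le.1 h2)⟩)
    · exact Or.inl ⟨ht, by simpa using hmem 0 (by omega) (by simpa using h1)⟩
  have hshift : ∀ s, (I.filter fun t => t + s ∈ B).card ≤ B.card := fun s =>
    Finset.card_le_card_of_injOn (fun t => t + s) (fun t ht => (Finset.mem_filter.1 ht).2)
      (fun a _ b _ h => by simpa using h)
  have h0 := hshift 0
  simp only [Nat.add_zero] at h0
  have hle := (Finset.card_le_card hcover).trans ((Finset.card_union_le _ _).trans
    (add_le_add h0 ((Finset.card_union_le _ _).trans (add_le_add (hshift m) (hshift (2 * m))))))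
  rw [hI, Nat.card_Icc] at hle
  omega

/-- Since `t(t - 1)` is even, `πat²` and `πat` agree modulo `2π`. This is the source of the lattice
vectors `(-πa, πa)`. -/
lemma cis_chirp_reduce (x β : ℝ) (a : ℤ) (t : ℕ) :
    cis (x * t + β * t ^ 2) =
      cis ((x + Real.pi * a) * t) * cis ((β - Real.pi * a) * t ^ 2) := by
  obtain ⟨s, hs⟩ : Even ((t : ℤ) * (t - 1)) := by
    rcases Int.even_or_odd (t : ℤ) with h | h
    · exact h.mul_right _
    · exact (h.sub_odd odd_one).mul_left _
  have hs' : (t : ℝ) * (t - 1) = s + s := by exact_mod_cast hs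
  rw [← cis_add, ← cis_sub_two_pi _ (a * s)]
  congr 1
  push_cast
  linear_combination (Real.pi * a) * hs'

/-- A Weyl mean of modulus close to one has frequencies close to a point of the lattice of trivial
frequencies `(2πk - πa, πa)`, and is itself close to one. -/
theorem near_lattice_of_weylMean_near_one {ρ : ℝ} (hρ : 0 < ρ) (hρ1 : ρ ≤ 1) :
    ∃ ε > 0, ∀ n : ℕ, 4 ≤ n → ∀ η : ℝ × ℝ, 1 - ε ≤ ‖weylMean n η‖ →
      ‖weylMean n η - 1‖ ≤ ρ ∧ ∃ a k : ℤ,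
        |η.1 - (2 * Real.pi * k - Real.pi * a)| ≤ ρ ∧ |η.2 - Real.pi * a| ≤ ρ := by
  set κ := ρ / 10000 with hκ
  have hκ0 : 0 < κ := by positivity
  refine ⟨κ ^ 2 / 16, by positivity, fun n hn η hη => ?_⟩
  set D := weylMean n η with hD
  set z : ℕ → ℂ := fun t => cis (chirpPhase η t) with hz
  have hz1 : ∀ t, ‖z t‖ = 1 := fun t => norm_cis _
  have hn0 : (0 : ℝ) < n := by
    have : 0 < n := by omega
    exact_mod_cast this
  have hnD : n * D = ∑ t ∈ Finset.Icc 1 n, z t := by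
    rw [hD, weylMean, mul_inv_cancel_left₀]
    exact_mod_cast hn0.ne'
  set M := n / 4 with hM
  have hM0 : 0 < M := by omega
  have hM8 : (n : ℝ) ≤ 8 * M := by
    have : n ≤ 8 * M := by omega
    exact_mod_cast this
  have hprog : ∀ m : ℕ, m ≤ M →
      ∃ t, t + m ≤ n ∧ ‖z t - D‖ ≤ κ ∧ ‖z (t + m) - D‖ ≤ κ ∧ ‖z (t + 2 * m) - D‖ ≤ κ := fun m hm =>
    exists_progression_near_mean hz1 (by omega) (by omega) hκ0 hnD hη
  have hclose : ∀ u v : ℂ, ‖u - D‖ ≤ κ → ‖v - D‖ ≤ κ → ‖u - v‖ ≤ 2 * κ := fun u v hu hv => by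
    calc ‖u - v‖ = ‖(u - D) - (v - D)‖ := by ring_nf
      _ ≤ κ + κ := (norm_sub_le _ _).trans (add_le_add hu hv)
      _ = _ := by ring
  obtain ⟨a, ha⟩ := exists_near_of_cis_mul_pow_near (c := 2 * η.2) (κ := 4 * κ) (M := M) (p := 2)
    le_rfl hM0 (by linarith) (fun m _ hm => by
      obtain ⟨t, -, h1, h2, h3⟩ := hprog m hm
      -- The second difference of the phase with step `m` is `2η₂m²`, independent of `t`.
      have hid : (cis (2 * η.2 * m ^ 2) - 1) * (z (t + m) * z (t + m)) =
          z t * (z (t + 2 * m) - z (t + m)) + (z t - z (t + m)) * z (t + m) := by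
        have : cis (2 * η.2 * m ^ 2) * (z (t + m) * z (t + m)) = z t * z (t + 2 * m) := by
          simp only [hz, ← cis_add]
          congr 1
          simp only [chirpPhase]; push_cast; ring
        linear_combination this
      have hnorm : ‖cis (2 * η.2 * m ^ 2) - 1‖ =
          ‖(cis (2 * η.2 * m ^ 2) - 1) * (z (t + m) * z (t + m))‖ := by
        rw [norm_mul, norm_mul, hz1, one_mul, mul_one]
      rw [hnorm, hid]
      refine (norm_add_le _ _).trans ?_
      rw [norm_mul, norm_mul, hz1, hz1, one_mul, mul_one]
      linarith [hclose _ _ h3 h2, hclose _ _ h1 h2])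
  set b := η.2 - Real.pi * a with hb
  have hbM : |b| * M ^ 2 ≤ 4 * κ := by
    have : 2 * η.2 - 2 * Real.pi * a = 2 * b := by rw [hb]; ring
    rw [this, abs_mul, abs_two] at ha
    linarith
  have hbn : |b| * n ^ 2 ≤ 256 * κ := by
    calc |b| * (n : ℝ) ^ 2 ≤ |b| * (8 * M) ^ 2 := by gcongr
      _ = 64 * (|b| * M ^ 2) := by ring
      _ ≤ _ := by linarith
  have hquad : ∀ t : ℕ, t ≤ n → ‖cis (b * t ^ 2) - 1‖ ≤ 256 * κ := fun t ht => by
    have ht' : (t : ℝ) ≤ n := by exact_mod_cast ht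
    refine (norm_cis_sub_one_le _).trans (le_trans ?_ hbn)
    rw [abs_mul, abs_of_nonneg (by positivity : (0 : ℝ) ≤ (t : ℝ) ^ 2)]
    gcongr
  have hzt : ∀ t, z t = cis ((η.1 + Real.pi * a) * t) * cis (b * t ^ 2) := fun t =>
    cis_chirp_reduce _ _ _ _
  have hlin : ∀ t : ℕ, t ≤ n → ‖z t - cis ((η.1 + Real.pi * a) * t)‖ ≤ 256 * κ := fun t ht => by
    rw [hzt, ← mul_sub_one, norm_mul, norm_cis, one_mul]
    exact hquad t ht
  -- With the quadratic part removed, first differences locate the linear frequency; `514 = 256 + 2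
  -- + 256`.
  obtain ⟨k, hk⟩ := exists_near_of_cis_mul_pow_near (c := η.1 + Real.pi * a) (κ := 514 * κ)
    (M := M) (p := 1) (by norm_num) hM0 (by linarith) (fun m _ hm => by
      obtain ⟨t, ht, h1, h2, -⟩ := hprog m hm
      set c := η.1 + Real.pi * a
      have hcm : c * (m : ℝ) ^ 1 = c * ((t + m : ℕ) : ℝ) - c * t := by push_cast; ring
      have h3 := hlin (t + m) ht
      rw [norm_sub_rev] at h3
      rw [hcm, ← norm_cis_sub_cis]
      calc _ = ‖(cis (c * ((t + m : ℕ) : ℝ)) - z (t + m)) + (z (t + m) - z t) +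
              (z t - cis (c * t))‖ := by ring_nf
        _ ≤ 256 * κ + 2 * κ + 256 * κ := norm_add₃_le.trans
            (add_le_add (add_le_add h3 (hclose _ _ h2 h1)) (hlin t (by omega)))
        _ = _ := by ring)
  set c := η.1 + Real.pi * a - 2 * Real.pi * k with hc
  have hcn : |c| * n ≤ 8224 * κ := by
    rw [pow_one] at hk
    calc |c| * (n : ℝ) ≤ |c| * (8 * M) := by gcongr
      _ = 8 * (|c| * M) := by ring
      _ ≤ _ := by linarith
  have hz_one : ∀ t : ℕ, t ≤ n → ‖z t - 1‖ ≤ ρ := fun t ht => by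
    have ht' : (t : ℝ) ≤ n := by exact_mod_cast ht
    have h1 : ‖cis ((η.1 + Real.pi * a) * t) - 1‖ ≤ 8224 * κ := by
      apply norm_cis_sub_one_le_of_near (k := k * t)
      have : (η.1 + Real.pi * a) * t - 2 * Real.pi * ((k * t : ℤ) : ℝ) = c * t := by
        rw [hc]; push_cast; ring
      rw [this, abs_mul, Nat.abs_cast]
      exact le_trans (by gcongr) hcn
    calc ‖z t - 1‖ = ‖(z t - cis ((η.1 + Real.pi * a) * t)) +
            (cis ((η.1 + Real.pi * a) * t) - 1)‖ := by ring_nf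
      _ ≤ 256 * κ + 8224 * κ := (norm_add_le _ _).trans (add_le_add (hlin t ht) h1)
      _ ≤ ρ := by linarith
  have hn1 : (1 : ℝ) ≤ n := by
    have : 1 ≤ n := by omega
    exact_mod_cast this
  refine ⟨?_, a, k, ?_, ?_⟩
  · have h1 : n * (D - 1) = ∑ t ∈ Finset.Icc 1 n, (z t - 1) := by
      rw [Finset.sum_sub_distrib, ← hnD]; simp; ring
    have h2 : n * ‖D - 1‖ ≤ n * ρ := by
      calc n * ‖D - 1‖ = ‖n * (D - 1)‖ := by rw [norm_mul, Complex.norm_natCast]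
        _ ≤ ∑ t ∈ Finset.Icc 1 n, ρ := by
            rw [h1]
            exact norm_sum_le_of_le _ fun t ht => hz_one t (Finset.mem_Icc.1 ht).2
        _ = _ := by simp
    exact le_of_mul_le_mul_left h2 hn0
  · have : η.1 - (2 * Real.pi * k - Real.pi * a) = c := by rw [hc]; ring
    rw [this]
    nlinarith [abs_nonneg c]
  · change |b| ≤ ρ
    nlinarith [abs_nonneg b, mul_le_mul_of_nonneg_left (one_le_pow₀ hn1 : 1 ≤ (n : ℝ) ^ 2) (abs_nonneg b)]

/-! ### Uniform decorrelation from quadratic phases. -/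

/-- A uniform van der Corput criterion: if all shifted correlations of a uniformly bounded family
of sequences have means tending to zero uniformly, then so do the sequences themselves. -/
theorem uniform_vanDerCorput {ι : Type*} {g : ι → ℕ → ℂ} {M : ℝ} (hM : 0 ≤ M)
    (hg : ∀ i t, ‖g i t‖ ≤ M)
    (hcorr : ∀ h k : ℕ, h ≠ k → ∀ ε > 0, ∀ᶠ n : ℕ in atTop, ∀ i,
      ‖∑ t ∈ Finset.Icc 1 n, g i (t + h) * (starRingEnd ℂ) (g i (t + k))‖ ≤ ε * n)
    {ε : ℝ} (hε : 0 < ε) :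
    ∀ᶠ n : ℕ in atTop, ∀ i, ‖∑ t ∈ Finset.Icc 1 n, g i t‖ ≤ ε * n := by
  -- `H` is large enough for the `H` diagonal correlations, each at most `M² n`, to be negligible
  -- against `H² ε² n`.
  obtain ⟨H, hH⟩ := exists_nat_gt (8 * M ^ 2 / ε ^ 2)
  have hH0 : (0 : ℝ) < H := lt_of_le_of_lt (by positivity) hH
  rw [div_lt_iff₀ (by positivity)] at hH
  have hall : ∀ᶠ n : ℕ in atTop, ∀ h ∈ Finset.range H, ∀ k ∈ Finset.range H, h ≠ k → ∀ i,
      ‖∑ t ∈ Finset.Icc 1 n, g i (t + h) * (starRingEnd ℂ) (g i (t + k))‖ ≤ ε ^ 2 / 8 * n := by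
    refine (Finset.eventually_all _).2 fun h _ => (Finset.eventually_all _).2 fun k _ => ?_
    by_cases hk : h = k
    · exact Eventually.of_forall fun n hne => absurd hk hne
    · filter_upwards [hcorr h k hk (ε ^ 2 / 8) (by positivity)] with n hn _ using hn
  obtain ⟨N, hN⟩ := exists_nat_gt (4 * H * M / ε)
  filter_upwards [hall, eventually_ge_atTop N] with n hn hnN i
  have hnN' : (N : ℝ) ≤ n := by exact_mod_cast hnN
  have hn4 : 4 * H * M < n * ε := by
    rw [div_lt_iff₀ hε] at hN
    nlinarith
  have h1 := vanDerCorput_average (hg i) n H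
  have h2 := vanDerCorput_square (g i) n H
  set T := ‖∑ t ∈ Finset.Icc 1 n, ∑ h ∈ Finset.range H, g i (t + h)‖
  have hterm : ∀ h ∈ Finset.range H, ∀ k ∈ Finset.range H,
      ‖∑ t ∈ Finset.Icc 1 n, g i (t + h) * (starRingEnd ℂ) (g i (t + k))‖ ≤
        ε ^ 2 / 8 * n + if h = k then M ^ 2 * (n : ℝ) else 0 := by
    intro h hh k hk
    by_cases he : h = k
    · rw [if_pos he]
      have : ‖∑ t ∈ Finset.Icc 1 n, g i (t + h) * (starRingEnd ℂ) (g i (t + k))‖ ≤ M ^ 2 * n := by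
        calc _ ≤ ∑ t ∈ Finset.Icc 1 n, M ^ 2 := norm_sum_le_of_le _ fun t _ => by
              rw [norm_mul, RCLike.norm_conj, sq]
              exact mul_le_mul (hg _ _) (hg _ _) (norm_nonneg _) hM
          _ = _ := by simp; ring
      have h0 : 0 ≤ ε ^ 2 / 8 * (n : ℝ) := by positivity
      linarith
    · rw [if_neg he, add_zero]; exact hn h hh k hk he i
  have hsum : ∑ h ∈ Finset.range H, ∑ k ∈ Finset.range H,
      ‖∑ t ∈ Finset.Icc 1 n, g i (t + h) * (starRingEnd ℂ) (g i (t + k))‖ ≤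
      H ^ 2 * (ε ^ 2 / 8 * n) + H * (M ^ 2 * n) := by
    refine (Finset.sum_le_sum fun h hh => Finset.sum_le_sum fun k hk => hterm h hh k hk).trans ?_
    apply le_of_eq
    simp_rw [Finset.sum_add_distrib, Finset.sum_ite_eq]
    rw [Finset.sum_ite_of_true (fun _ h => h)]
    simp; ring
  have hTsq : T ^ 2 ≤ (H * (n * ε) / 2) ^ 2 := by
    have hn0 : (0 : ℝ) ≤ n := Nat.cast_nonneg n
    calc T ^ 2 ≤ n * (H ^ 2 * (ε ^ 2 / 8 * n) + H * (M ^ 2 * n)) :=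
          h2.trans (mul_le_mul_of_nonneg_left hsum hn0)
      _ = n ^ 2 * H * (H * ε ^ 2 / 8 + M ^ 2) := by ring
      _ ≤ n ^ 2 * H * (H * ε ^ 2 / 8 + H * ε ^ 2 / 8) := by gcongr; linarith
      _ = _ := by ring
  have hT : T ≤ H * (n * ε) / 2 := le_of_sq_le_sq hTsq (by positivity)
  refine le_of_mul_le_mul_left (?_ : (H : ℝ) * _ ≤ H * _) hH0
  nlinarith

/-- The fourfold products controlling the correlations of a sequence with quadratic phases. -/
def cubeProduct (v : ℕ → ℝ) (h h' k k' t : ℕ) : ℝ :=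
  v (t + k + h) * v (t + k + h') * v (t + k' + h) * v (t + k' + h')

/-- A bounded sequence whose cube products have vanishing means is uniformly uncorrelated with
all quadratic phases. -/
theorem uniform_chirp_mean_of_cubeProduct {v : ℕ → ℝ} {M : ℝ} (hv : ∀ t, |v t| ≤ M)
    (hcube : ∀ h h' k k' : ℕ, h < h' → k < k' →
      Tendsto (fun n : ℕ => (∑ t ∈ Finset.Icc 1 n, cubeProduct v h h' k k' t) / (n : ℝ))
        atTop (𝓝 0))
    {ε : ℝ} (hε : 0 < ε) :
    ∀ᶠ n : ℕ in atTop, ∀ θ : ℝ × ℝ,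
      ‖∑ t ∈ Finset.Icc 1 n, (v t : ℂ) * cis (-chirpPhase θ t)‖ ≤ ε * n := by
  have hM : 0 ≤ M := (abs_nonneg _).trans (hv 0)
  have hcube' : ∀ h h' k k' : ℕ, h ≠ h' → k ≠ k' → ∀ ε > 0, ∀ᶠ n : ℕ in atTop,
      |∑ t ∈ Finset.Icc 1 n, cubeProduct v h h' k k' t| ≤ ε * n := by
    have hs1 : ∀ h h' k k' t, cubeProduct v h h' k k' t = cubeProduct v h' h k k' t := by
      intros; simp only [cubeProduct]; ring
    have hs2 : ∀ h h' k k' t, cubeProduct v h h' k k' t = cubeProduct v h h' k' k t := by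
      intros; simp only [cubeProduct]; ring
    intro h h' k k' hh hk ε hε
    have hlim : Tendsto (fun n : ℕ => (∑ t ∈ Finset.Icc 1 n, cubeProduct v h h' k k' t) / (n : ℝ))
        atTop (𝓝 0) := by
      rcases lt_or_gt_of_ne hh with h1 | h1 <;> rcases lt_or_gt_of_ne hk with h2 | h2
      · exact hcube _ _ _ _ h1 h2
      · simp_rw [hs2 h h' k k']; exact hcube _ _ _ _ h1 h2
      · simp_rw [hs1 h h' k k']; exact hcube _ _ _ _ h1 h2
      · simp_rw [hs1 h h' k k', hs2 h' h k k']; exact hcube _ _ _ _ h1 h2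
    filter_upwards [(Metric.tendsto_nhds.1 hlim) ε hε, eventually_gt_atTop 0] with n hn hn0
    have hn0' : (0 : ℝ) < n := by exact_mod_cast hn0
    rw [Real.dist_eq, sub_zero, abs_div, Nat.abs_cast, div_lt_iff₀ hn0'] at hn
    exact hn.le
  -- Each application differences the phase once. After two, a constant unimodular factor remains,
  -- so the bound no longer depends on `θ`.
  refine uniform_vanDerCorput (g := fun θ t => (v t : ℂ) * cis (-chirpPhase θ t)) hM
    (fun θ t => by simpa using hv t) (fun h h' hh => ?_) hε
  intro ε₁ hε₁
  refine uniform_vanDerCorput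
    (g := fun θ t => (v (t + h) : ℂ) * cis (-chirpPhase θ (t + h)) *
      (starRingEnd ℂ) ((v (t + h') : ℂ) * cis (-chirpPhase θ (t + h'))))
    (mul_nonneg hM hM) (fun θ t => ?_) (fun k k' hk => ?_) hε₁
  · rw [norm_mul, RCLike.norm_conj, norm_mul, norm_mul, norm_cis, norm_cis, mul_one, mul_one,
      Complex.norm_real, Complex.norm_real]
    exact mul_le_mul (hv _) (hv _) (norm_nonneg _) hM
  intro ε₂ hε₂
  filter_upwards [hcube' h h' k k' hh hk ε₂ hε₂] with n hn θ
  refine le_trans (le_of_eq ?_) hn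
  have hterm : ∀ t : ℕ, (v (t + k + h) : ℂ) * cis (-chirpPhase θ (t + k + h)) *
      (starRingEnd ℂ) ((v (t + k + h') : ℂ) * cis (-chirpPhase θ (t + k + h'))) *
      (starRingEnd ℂ) ((v (t + k' + h) : ℂ) * cis (-chirpPhase θ (t + k' + h)) *
      (starRingEnd ℂ) ((v (t + k' + h') : ℂ) * cis (-chirpPhase θ (t + k' + h')))) =
      cis (-2 * θ.2 * (k - k') * (h - h')) * (cubeProduct v h h' k k' t : ℂ) := by
    intro t
    have hph : cis (-2 * θ.2 * (k - k') * (h - h')) = cis (-chirpPhase θ (t + k + h)) *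
        cis (chirpPhase θ (t + k + h')) * cis (chirpPhase θ (t + k' + h)) *
        cis (-chirpPhase θ (t + k' + h')) := by
      rw [← cis_add, ← cis_add, ← cis_add]
      congr 1
      simp only [chirpPhase]; push_cast; ring
    rw [hph]
    simp only [map_mul, Complex.conj_ofReal, conj_cis, neg_neg, cubeProduct]
    push_cast; ring
  simp only [hterm]
  rw [← Finset.mul_sum, norm_mul, norm_cis, one_mul, ← Complex.ofReal_sum, Complex.norm_real,
    Real.norm_eq_abs]

/-! ### A strong law for bounded orthogonal variables. -/

/-- Between `k²` and the next square, `s` moves by at most `2kM`, which is negligible against `k²`.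
-/
lemma tendsto_div_of_tendsto_squares {s : ℕ → ℝ} {M : ℝ} (hs : ∀ n, |s (n + 1) - s n| ≤ M)
    (hlim : Tendsto (fun k : ℕ => s (k ^ 2) / (k : ℝ) ^ 2) atTop (𝓝 0)) :
    Tendsto (fun n : ℕ => s n / (n : ℝ)) atTop (𝓝 0) := by
  have hM : 0 ≤ M := (abs_nonneg _).trans (hs 0)
  have hstep : ∀ a b : ℕ, |s (a + b) - s a| ≤ b * M := by
    intro a b
    induction b with
    | zero => simp
    | succ b ih =>
      calc |s (a + (b + 1)) - s a| = |(s (a + b + 1) - s (a + b)) + (s (a + b) - s a)| := by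
            rw [← add_assoc]; ring_nf
        _ ≤ M + b * M := (abs_add_le _ _).trans (add_le_add (hs _) ih)
        _ = _ := by push_cast; ring
  have hsqrt : Tendsto Nat.sqrt atTop atTop :=
    tendsto_atTop.2 fun b => by
      filter_upwards [eventually_ge_atTop (b ^ 2)] with n hn
      exact Nat.le_sqrt'.2 hn
  have hbound : Tendsto (fun k : ℕ => |s (k ^ 2) / (k : ℝ) ^ 2| + 2 * M / (k : ℝ)) atTop (𝓝 0) := by
    simpa using hlim.abs.add (tendsto_const_div_atTop_nhds_zero_nat (2 * M))
  refine squeeze_zero_norm' ?_ (hbound.comp hsqrt)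
  filter_upwards [eventually_gt_atTop 0] with n hn
  set k := Nat.sqrt n with hk
  have hk0 : 0 < k := Nat.sqrt_pos.2 hn
  have hkn : k ^ 2 ≤ n := Nat.sqrt_le' n
  have hnk : n ≤ k ^ 2 + 2 * k := by
    have := Nat.sqrt_le_add n
    rw [← hk] at this
    nlinarith
  have hk0' : (0 : ℝ) < k := by exact_mod_cast hk0
  have hn0' : (0 : ℝ) < n := by exact_mod_cast hn
  have hkn' : (k : ℝ) ^ 2 ≤ n := by exact_mod_cast hkn
  have h1 : |s n| ≤ |s (k ^ 2)| + 2 * k * M := by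
    have := hstep (k ^ 2) (n - k ^ 2)
    rw [Nat.add_sub_cancel' hkn] at this
    have h2 : ((n - k ^ 2 : ℕ) : ℝ) ≤ 2 * k := by
      have : n - k ^ 2 ≤ 2 * k := by omega
      exact_mod_cast this
    have h3 : |s n| ≤ |s n - s (k ^ 2)| + |s (k ^ 2)| := by
      linarith [abs_sub_abs_le_abs_sub (s n) (s (k ^ 2))]
    nlinarith
  simp only [Function.comp, Real.norm_eq_abs]
  rw [abs_div, Nat.abs_cast, abs_div, abs_of_pos (by positivity : (0 : ℝ) < (k : ℝ) ^ 2)]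
  calc |s n| / n ≤ (|s (k ^ 2)| + 2 * k * M) / n := by gcongr
    _ ≤ (|s (k ^ 2)| + 2 * k * M) / (k : ℝ) ^ 2 := by gcongr
    _ = |s (k ^ 2)| / (k : ℝ) ^ 2 + 2 * M / k := by field_simp

/-- The strong law of large numbers for bounded orthogonal random variables. -/
theorem strong_law_of_bounded_orthogonal {Ω : Type*} [MeasurableSpace Ω] {μ : Measure Ω}
    [IsProbabilityMeasure μ] {X : ℕ → Ω → ℝ} {M : ℝ} (hX : ∀ t, AEStronglyMeasurable (X t) μ)
    (hM : ∀ t ω, |X t ω| ≤ M) (horth : ∀ s t, 0 < s → s < t → ∫ ω, X s ω * X t ω ∂μ = 0) :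
    ∀ᵐ ω ∂μ, Tendsto (fun n : ℕ => (∑ t ∈ Finset.Icc 1 n, X t ω) / (n : ℝ)) atTop (𝓝 0) := by
  have hint : ∀ s t, Integrable (fun ω => X s ω * X t ω) μ := fun s t =>
    Integrable.of_bound ((hX s).mul (hX t)) (M * M) (Eventually.of_forall fun ω => by
      rw [norm_mul]
      exact mul_le_mul (hM _ _) (hM _ _) (norm_nonneg _) ((abs_nonneg _).trans (hM s ω)))
  have hsq : ∀ (n : ℕ) (ω : Ω), (∑ t ∈ Finset.Icc 1 n, X t ω) ^ 2 =
      ∑ s ∈ Finset.Icc 1 n, ∑ t ∈ Finset.Icc 1 n, X s ω * X t ω := fun n ω => by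
    rw [sq, Finset.sum_mul_sum]
  have hintsq : ∀ n : ℕ, Integrable (fun ω => (∑ t ∈ Finset.Icc 1 n, X t ω) ^ 2) μ := fun n => by
    simp_rw [hsq]
    exact integrable_finsetSum _ fun s _ => integrable_finsetSum _ fun t _ => hint s t
  have hvar : ∀ n : ℕ, ∫ ω, (∑ t ∈ Finset.Icc 1 n, X t ω) ^ 2 ∂μ ≤ n * M ^ 2 := by
    intro n
    simp_rw [hsq]
    rw [integral_finsetSum _ fun s _ => integrable_finsetSum _ fun t _ => hint s t]
    have hrow : ∀ s ∈ Finset.Icc 1 n,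
        ∫ ω, ∑ t ∈ Finset.Icc 1 n, X s ω * X t ω ∂μ ≤ M ^ 2 := by
      intro s hs
      rw [integral_finsetSum _ fun t _ => hint s t, Finset.sum_eq_single_of_mem s hs]
      · have h1 : ∫ ω, X s ω * X s ω ∂μ ≤ ∫ _, M ^ 2 ∂μ :=
          integral_mono (hint s s) (integrable_const _) fun ω => by
            have := hM s ω
            change X s ω * X s ω ≤ M ^ 2
            rw [← abs_mul_abs_self, sq]
            exact mul_self_le_mul_self (abs_nonneg _) this
        simpa using h1
      · intro t ht hne
        rcases lt_or_gt_of_ne hne with h | h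
        · simp_rw [mul_comm (X s _)]
          exact horth t s (Finset.mem_Icc.1 ht).1 h
        · exact horth s t (Finset.mem_Icc.1 hs).1 h
    refine (Finset.sum_le_sum hrow).trans (le_of_eq ?_)
    simp
  -- Along squares the second moments are at most `M²/k²`, hence summable, so `∑ Y k` is finite
  -- almost surely.
  set Y : ℕ → Ω → ℝ := fun k ω => ((∑ t ∈ Finset.Icc 1 (k ^ 2), X t ω) / (k : ℝ) ^ 2) ^ 2 with hY
  have hYint : ∀ k, Integrable (Y k) μ := fun k => by
    simp_rw [hY, div_pow]
    exact (hintsq _).div_const _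
  have hYle : ∀ k, ∫ ω, Y k ω ∂μ ≤ M ^ 2 * (1 / (k : ℝ) ^ 2) := fun k => by
    simp_rw [hY, div_pow]
    rw [integral_div]
    rcases Nat.eq_zero_or_pos k with rfl | hk
    · simp
    · have hk' : (0 : ℝ) < k := by exact_mod_cast hk
      rw [div_le_iff₀ (by positivity)]
      refine (hvar _).trans (le_of_eq ?_)
      push_cast; field_simp
  have hfin : ∫⁻ ω, ∑' k, ENNReal.ofReal (Y k ω) ∂μ ≠ ⊤ := by
    rw [lintegral_tsum fun k => (hYint k).1.aemeasurable.ennreal_ofReal]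
    have hsum : Summable fun k : ℕ => M ^ 2 * (1 / (k : ℝ) ^ 2) :=
      (Real.summable_one_div_nat_pow.2 one_lt_two).mul_left _
    refine ne_top_of_le_ne_top hsum.tsum_ofReal_ne_top (ENNReal.tsum_le_tsum fun k => ?_)
    rw [← ofReal_integral_eq_lintegral_ofReal (hYint k)
      (Eventually.of_forall fun ω => sq_nonneg _)]
    exact ENNReal.ofReal_le_ofReal (hYle k)
  have hae := ae_lt_top' (AEMeasurable.tsum fun k =>
    (hYint k).1.aemeasurable.ennreal_ofReal) hfin
  filter_upwards [hae] with ω hω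
  have h0 := ENNReal.tendsto_atTop_zero_of_tsum_ne_top hω.ne
  have h1 : Tendsto (fun k => Y k ω) atTop (𝓝 0) := by
    have := (ENNReal.tendsto_toReal ENNReal.zero_ne_top).comp h0
    simpa [Function.comp_def, hY, ENNReal.toReal_ofReal (sq_nonneg _)] using this
  have h2 : Tendsto (fun k : ℕ => (∑ t ∈ Finset.Icc 1 (k ^ 2), X t ω) / (k : ℝ) ^ 2) atTop
      (𝓝 0) := by
    have := h1.sqrt
    rw [Real.sqrt_zero] at this
    simp_rw [hY, Real.sqrt_sq_eq_abs] at this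
    exact (tendsto_zero_iff_abs_tendsto_zero _).2 this
  refine tendsto_div_of_tendsto_squares (s := fun n => ∑ t ∈ Finset.Icc 1 n, X t ω) (M := M)
    (fun n => ?_) h2
  rw [Finset.sum_Icc_succ_top (by omega), add_sub_cancel_left]
  exact hM _ _

/-! ### Noise: bounded case, truncation and the uniform law. -/

section Noise

variable {Ω : Type*} [MeasurableSpace Ω] {μ : Measure Ω}

/-- A centred variable of an independent sequence is orthogonal to functions of the earlier ones. -/
lemma integral_mul_past_eq_zero {u : ℕ → Ω → ℝ} (hu : iIndepFun u μ)
    (hmeas : ∀ t, AEMeasurable (u t) μ) (i : ℕ) (hi : ∫ ω, u i ω ∂μ = 0)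
    {F : (Finset.range i → ℝ) → ℝ} (hF : Measurable F) :
    ∫ ω, u i ω * F (fun j => u j ω) ∂μ = 0 := by
  have hind := hu.indepFun_finset₀ {i} (Finset.range i) (by simp) hmeas
  have h2 : IndepFun (u i) (fun ω => F (fun j => u j ω)) μ :=
    hind.comp (φ := fun v : ({i} : Finset ℕ) → ℝ => v ⟨i, Finset.mem_singleton_self i⟩)
      (measurable_pi_apply _) hF
  rw [h2.integral_fun_mul_eq_mul_integral (hmeas i).aestronglyMeasurable
    (hF.comp_aemeasurable (aemeasurable_pi_lambda _ fun j => hmeas j)).aestronglyMeasurable, hi,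
    zero_mul]

/-- For a bounded centred noise the cube products have vanishing means almost surely. -/
lemma ae_tendsto_cubeProduct_mean [IsProbabilityMeasure μ] {v : ℕ → Ω → ℝ} {M : ℝ}
    (hindep : iIndepFun (fun t => v (t + 1)) μ) (hmeas : ∀ t, AEMeasurable (v (t + 1)) μ)
    (hmean : ∀ t, ∫ ω, v (t + 1) ω ∂μ = 0) (hM : ∀ t ω, |v (t + 1) ω| ≤ M)
    {h h' k k' : ℕ} (hh : h < h') (hk : k < k') :
    ∀ᵐ ω ∂μ, Tendsto (fun n : ℕ =>
      (∑ t ∈ Finset.Icc 1 n, cubeProduct (fun t => v t ω) h h' k k' t) / (n : ℝ)) atTop (𝓝 0) := by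
  set u : ℕ → Ω → ℝ := fun t => v (t + 1) with hu
  -- `u` starts at time one, hence `t - 1`. At `t = 0` the subtraction truncates and `X 0 = X 1`,
  -- which is why orthogonality is claimed for positive indices only.
  set X : ℕ → Ω → ℝ := fun t ω => u (t - 1 + k + h) ω * u (t - 1 + k + h') ω *
    u (t - 1 + k' + h) ω * u (t - 1 + k' + h') ω with hX
  have hXcube : ∀ t ∈ {t | 0 < t}, ∀ ω, cubeProduct (fun t => v t ω) h h' k k' t = X t ω := by
    intro t ht ω
    obtain ⟨s, rfl⟩ := Nat.exists_eq_succ_of_ne_zero (Nat.pos_iff_ne_zero.1 ht)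
    have e : ∀ a b : ℕ, s + 1 + a + b = s + a + b + 1 := fun a b => by ring
    simp only [cubeProduct, hX, hu, Nat.succ_eq_add_one, Nat.add_sub_cancel, e]
  have hXmeas : ∀ t, AEStronglyMeasurable (X t) μ := fun t =>
    ((((hmeas _).mul (hmeas _)).mul (hmeas _)).mul (hmeas _)).aestronglyMeasurable
  have hXM : ∀ t ω, |X t ω| ≤ M * M * M * M := fun t ω => by
    have hM0 : 0 ≤ M := (abs_nonneg _).trans (hM 0 ω)
    simp only [hX, abs_mul]
    exact mul_le_mul (mul_le_mul (mul_le_mul (hM _ _) (hM _ _) (abs_nonneg _) hM0) (hM _ _)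
      (abs_nonneg _) (by positivity)) (hM _ _) (abs_nonneg _) (by positivity)
  have horth : ∀ s t, 0 < s → s < t → ∫ ω, X s ω * X t ω ∂μ = 0 := by
    intro s t hs hst
    -- The index `t - 1 + k' + h'` strictly exceeds the other seven in `X s * X t`, so that factor
    -- is independent of the rest and centred.
    have m : ∀ a, a < t - 1 + k' + h' → a ∈ Finset.range (t - 1 + k' + h') := fun a ha =>
      Finset.mem_range.2 ha
    have key := integral_mul_past_eq_zero hindep hmeas (t - 1 + k' + h') (hmean _)
      (F := fun w => w ⟨s - 1 + k + h, m _ (by omega)⟩ * w ⟨s - 1 + k + h', m _ (by omega)⟩ *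
        w ⟨s - 1 + k' + h, m _ (by omega)⟩ * w ⟨s - 1 + k' + h', m _ (by omega)⟩ *
        (w ⟨t - 1 + k + h, m _ (by omega)⟩ * w ⟨t - 1 + k + h', m _ (by omega)⟩ *
        w ⟨t - 1 + k' + h, m _ (by omega)⟩)) (by fun_prop)
    rw [← key]
    refine integral_congr_ae (Eventually.of_forall fun ω => ?_)
    simp only [hX, hu]; ring
  filter_upwards [strong_law_of_bounded_orthogonal hXmeas hXM horth] with ω hω
  refine hω.congr fun n => ?_
  congr 1
  exact Finset.sum_congr rfl fun t ht => (hXcube t (Finset.mem_Icc.1 ht).1 ω).symm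

/-- The exceptional null sets are indexed by quadruples of shifts, not by `θ`, so their union is
null. -/
lemma ae_uniform_chirp_mean_of_bounded [IsProbabilityMeasure μ] {v : ℕ → Ω → ℝ} {M : ℝ}
    (hindep : iIndepFun (fun t => v (t + 1)) μ) (hmeas : ∀ t, AEMeasurable (v (t + 1)) μ)
    (hmean : ∀ t, ∫ ω, v (t + 1) ω ∂μ = 0) (hM : ∀ t ω, |v t ω| ≤ M) :
    ∀ᵐ ω ∂μ, ∀ ε > 0, ∀ᶠ n : ℕ in atTop, ∀ θ : ℝ × ℝ,
      ‖∑ t ∈ Finset.Icc 1 n, (v t ω : ℂ) * cis (-chirpPhase θ t)‖ ≤ ε * n := by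
  have hae : ∀ᵐ ω ∂μ, ∀ h h' k k' : ℕ, h < h' → k < k' → Tendsto (fun n : ℕ =>
      (∑ t ∈ Finset.Icc 1 n, cubeProduct (fun t => v t ω) h h' k k' t) / (n : ℝ))
      atTop (𝓝 0) := by
    simp only [ae_all_iff]
    intro h h' k k' hh hk
    exact ae_tendsto_cubeProduct_mean hindep hmeas hmean (fun t => hM (t + 1)) hh hk
  filter_upwards [hae] with ω hω ε hε
  exact uniform_chirp_mean_of_cubeProduct (fun t => hM t ω) hω hε

/-- Truncation of a real number at level `m`. -/
noncomputable def truncAt (m : ℕ) (x : ℝ) : ℝ := if |x| ≤ m then x else 0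

lemma measurable_truncAt (m : ℕ) : Measurable (truncAt m) :=
  Measurable.ite (measurableSet_le measurable_norm measurable_const) measurable_id measurable_const

lemma abs_truncAt_le (m : ℕ) (x : ℝ) : |truncAt m x| ≤ m := by
  unfold truncAt; split_ifs with h <;> simp [h]

lemma abs_truncAt_le_abs (m : ℕ) (x : ℝ) : |truncAt m x| ≤ |x| := by
  unfold truncAt; split_ifs with h <;> simp

lemma abs_sub_truncAt_le (m : ℕ) (x : ℝ) : |x - truncAt m x| ≤ |x| := by
  unfold truncAt; split_ifs with h <;> simp

lemma tendsto_integral_abs_sub_truncAt {X : Ω → ℝ} (hX : Integrable X μ) :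
    Tendsto (fun m : ℕ => ∫ ω, |X ω - truncAt m (X ω)| ∂μ) atTop (𝓝 0) := by
  have := tendsto_integral_of_dominated_convergence (μ := μ)
    (F := fun (m : ℕ) ω => |X ω - truncAt m (X ω)|) (f := fun _ => 0) (fun ω => |X ω|)
    (fun m => (hX.1.aemeasurable.sub
      ((measurable_truncAt m).comp_aemeasurable hX.1.aemeasurable)).abs.aestronglyMeasurable)
    hX.abs (fun m => Eventually.of_forall fun ω => by
      rw [Real.norm_eq_abs, abs_abs]; exact abs_sub_truncAt_le _ _)
    (Eventually.of_forall fun ω => by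
      refine tendsto_const_nhds.congr' ?_
      obtain ⟨N, hN⟩ := exists_nat_ge |X ω|
      filter_upwards [eventually_ge_atTop N] with m hm
      have : |X ω| ≤ m := hN.trans (by exact_mod_cast hm)
      simp [truncAt, this])
  simpa using this

/-- Uniform law of large numbers: the correlations of an i.i.d. centred noise with all chirps tend
to zero uniformly in the frequencies. -/
theorem ae_uniform_chirp_mean [IsProbabilityMeasure μ] {e : ℕ → Ω → ℝ}
    (hindep : iIndepFun (fun t => e (t + 1)) μ)
    (hident : ∀ t, IdentDistrib (e (t + 1)) (e 1) μ μ) (hint : Integrable (e 1) μ)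
    (hmean : ∫ ω, e 1 ω ∂μ = 0) :
    ∀ᵐ ω ∂μ, ∀ ε > 0, ∀ᶠ n : ℕ in atTop, ∀ θ : ℝ × ℝ,
      ‖∑ t ∈ Finset.Icc 1 n, (e t ω : ℂ) * cis (-chirpPhase θ t)‖ ≤ ε * n := by
  set c : ℕ → ℝ := fun m => ∫ ω, truncAt m (e 1 ω) ∂μ with hc
  set a : ℕ → ℝ := fun m => ∫ ω, |e 1 ω - truncAt m (e 1 ω)| ∂μ with ha
  have hmeas : ∀ t, AEMeasurable (e (t + 1)) μ := fun t => (hident t).aemeasurable_fst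
  have htint : ∀ m, Integrable (fun ω => truncAt m (e 1 ω)) μ := fun m =>
    hint.mono ((measurable_truncAt m).comp_aemeasurable (hmeas 0)).aestronglyMeasurable
      (Eventually.of_forall fun ω => abs_truncAt_le_abs m _)
  have hca : ∀ m, |c m| ≤ a m := fun m => by
    have : c m = -∫ ω, (e 1 ω - truncAt m (e 1 ω)) ∂μ := by
      rw [integral_sub hint (htint m), hmean]; simp [hc]
    rw [this, abs_neg]
    exact abs_integral_le_integral_abs
  have hmain : ∀ m : ℕ, ∀ᵐ ω ∂μ, ∀ ε > 0, ∀ᶠ n : ℕ in atTop, ∀ θ : ℝ × ℝ,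
      ‖∑ t ∈ Finset.Icc 1 n, ((truncAt m (e t ω) - c m : ℝ) : ℂ) * cis (-chirpPhase θ t)‖
        ≤ ε * n := by
    intro m
    have hgm : Measurable fun x => truncAt m x - c m := (measurable_truncAt m).sub_const _
    refine ae_uniform_chirp_mean_of_bounded (v := fun t ω => truncAt m (e t ω) - c m)
      (M := m + |c m|) (hindep.comp (fun _ x => truncAt m x - c m) fun _ => hgm)
      (fun t => hgm.comp_aemeasurable (hmeas t)) (fun t => ?_) (fun t ω => ?_)
    · have h1 := ((hident t).comp hgm).integral_eq
      simp only [Function.comp_def] at h1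
      rw [h1, integral_sub (htint m) (integrable_const _)]
      simp [hc]
    · exact (abs_sub _ _).trans (add_le_add (abs_truncAt_le _ _) le_rfl)
  have hrest : ∀ m : ℕ, ∀ᵐ ω ∂μ, Tendsto (fun n : ℕ =>
      (∑ t ∈ Finset.range n, |e (t + 1) ω - truncAt m (e (t + 1) ω)|) / (n : ℝ))
      atTop (𝓝 (a m)) := by
    intro m
    have hgm : Measurable fun x => |x - truncAt m x| :=
      (measurable_id.sub (measurable_truncAt m)).abs
    exact strong_law_ae_real (fun t ω => |e (t + 1) ω - truncAt m (e (t + 1) ω)|)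
      (hint.sub (htint m)).abs
      (fun i j hij => (hindep.indepFun hij).comp hgm hgm) (fun t => (hident t).comp hgm)
  filter_upwards [ae_all_iff.2 hmain, ae_all_iff.2 hrest] with ω h1 h2 ε hε
  -- Three errors of `ε/4` arise: the recentred truncated noise, the mean of the tails, and the
  -- recentring constant, bounded by `a m`.
  obtain ⟨m, hm⟩ : ∃ m, a m < ε / 4 :=
    ((tendsto_integral_abs_sub_truncAt hint).eventually_lt_const (by positivity)).exists
  filter_upwards [h1 m (ε / 4) (by positivity), (h2 m).eventually_lt_const hm,
    eventually_gt_atTop 0] with n hn1 hn2 hn0 θ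
  have hn0' : (0 : ℝ) < n := by exact_mod_cast hn0
  rw [div_lt_iff₀ hn0'] at hn2
  have hsplit : ∑ t ∈ Finset.Icc 1 n, (e t ω : ℂ) * cis (-chirpPhase θ t) =
      ∑ t ∈ Finset.Icc 1 n, ((truncAt m (e t ω) - c m : ℝ) : ℂ) * cis (-chirpPhase θ t) +
      ∑ t ∈ Finset.Icc 1 n, ((e t ω - truncAt m (e t ω) + c m : ℝ) : ℂ) *
        cis (-chirpPhase θ t) := by
    rw [← Finset.sum_add_distrib]
    exact Finset.sum_congr rfl fun t _ => by push_cast; ring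
  have hrange : ∑ t ∈ Finset.Icc 1 n, |e t ω - truncAt m (e t ω)| =
      ∑ t ∈ Finset.range n, |e (t + 1) ω - truncAt m (e (t + 1) ω)| := by
    rw [Finset.range_eq_Ico, Finset.sum_Ico_add' (fun t => |e t ω - truncAt m (e t ω)|) 0 n 1]
    rfl
  have hR : ‖∑ t ∈ Finset.Icc 1 n, ((e t ω - truncAt m (e t ω) + c m : ℝ) : ℂ) *
      cis (-chirpPhase θ t)‖ ≤ ε / 4 * n + ε / 4 * n := by
    calc _ ≤ ∑ t ∈ Finset.Icc 1 n, (|e t ω - truncAt m (e t ω)| + |c m|) :=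
          norm_sum_le_of_le _ fun t _ => by
            rw [norm_mul, norm_cis, mul_one, Complex.norm_real]
            exact abs_add_le _ _
      _ = (∑ t ∈ Finset.range n, |e (t + 1) ω - truncAt m (e (t + 1) ω)|) + n * |c m| := by
          rw [Finset.sum_add_distrib, hrange]; simp
      _ ≤ _ := by
          have := hca m
          have : n * |c m| ≤ n * (ε / 4) := by gcongr; linarith
          linarith
  rw [hsplit]
  refine (norm_add_le _ _).trans ((add_le_add (hn1 θ) hR).trans ?_)
  have : 0 ≤ ε * n := by positivity
  linarith

end Noise

/-! ### Symmetries of chirps and identifiability. -/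

lemma cis_re (x : ℝ) : (cis x).re = Real.cos x := Complex.exp_ofReal_mul_I_re x

lemma cis_im (x : ℝ) : (cis x).im = Real.sin x := Complex.exp_ofReal_mul_I_im x

lemma chirpSignal_congr {θ θ' : ℝ × ℝ} {t : ℕ} (h : cis (chirpPhase θ t) = cis (chirpPhase θ' t))
    (A B : ℝ) : chirpSignal A B θ t = chirpSignal A B θ' t := by
  simp only [chirpSignal, ← cis_re, ← cis_im, h]

lemma cis_chirpPhase_add_lattice (θ : ℝ × ℝ) (a k : ℤ) (t : ℕ) :
    cis (chirpPhase (θ + (2 * Real.pi * k - Real.pi * a, Real.pi * a)) t) =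
      cis (chirpPhase θ t) := by
  have h := cis_chirp_reduce (θ.1 + (2 * Real.pi * k - Real.pi * a)) (θ.2 + Real.pi * a) a t
  have h1 : (θ.1 + (2 * Real.pi * k - Real.pi * a) + Real.pi * a) * t =
      θ.1 * t + 2 * Real.pi * ((k * t : ℤ) : ℝ) := by push_cast; ring
  rw [h1, cis_add (θ.1 * t), cis_int_mul_two_pi, mul_one, ← cis_add, add_sub_cancel_right] at h
  exact h

lemma chirpFamily_add_lattice (θ : ℝ × ℝ) (a k : ℤ) :
    chirpFamily (θ + (2 * Real.pi * k - Real.pi * a, Real.pi * a)) = chirpFamily θ := by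
  ext s
  simp only [chirpFamily, Set.mem_ofPred_eq,
    chirpSignal_congr (cis_chirpPhase_add_lattice θ a k _)]

/-- The sign of `B` absorbs the sign of the phase. Identifiability thus forbids two distinct
admissible frequencies `θ` and `-θ`. -/
lemma chirpFamily_neg (θ : ℝ × ℝ) : chirpFamily (-θ) = chirpFamily θ := by
  have h : ∀ A B t, chirpSignal A B (-θ) t = chirpSignal A (-B) θ t := fun A B t => by
    simp only [chirpSignal, chirpPhase_neg, Real.cos_neg, Real.sin_neg]; ring
  ext s
  simp only [chirpFamily, Set.mem_ofPred_eq, h]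
  constructor
  · rintro ⟨A, B, hs⟩
    exact ⟨A, -B, hs⟩
  · rintro ⟨A, B, hs⟩
    exact ⟨A, -B, by simpa using hs⟩

lemma weylMean_add_lattice (n : ℕ) (θ : ℝ × ℝ) (a k : ℤ) :
    weylMean n (θ + (2 * Real.pi * k - Real.pi * a, Real.pi * a)) = weylMean n θ := by
  simp only [weylMean, cis_chirpPhase_add_lattice]

/-- If the noiseless correlation at an admissible frequency is almost maximal, then the frequency
is close to the true one, even on the scale on which the Weyl means vary. -/
theorem frequency_close_of_large_correlation {T : Set (ℝ × ℝ)} (hT : FrequencyIdentifiable T)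
    {θ₀ : ℝ × ℝ} (hθT : T ∈ 𝓝 θ₀)
    (hθ : ¬ ((∃ r : ℚ, θ₀.1 = r * Real.pi) ∧ (∃ s : ℚ, θ₀.2 = s * Real.pi)))
    {C : ℂ} (hC : C ≠ 0) {ρ : ℝ} (hρ : 0 < ρ) :
    ∃ ν > 0, ∀ᶠ n : ℕ in atTop, ∀ θ ∈ T,
      ‖C‖ - ν ≤ ‖C * weylMean n (θ₀ - θ) + (starRingEnd ℂ) C * weylMean n (-θ₀ - θ)‖ →
      dist θ θ₀ ≤ ρ ∧ ‖weylMean n (θ₀ - θ) - 1‖ ≤ ρ ∧ ‖weylMean n (-θ₀ - θ)‖ ≤ ρ := by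
  obtain ⟨r, hr, hball⟩ := Metric.mem_nhds_iff.1 hθT
  -- Points within `ρ` of `θ₀` in each coordinate must lie in the ball of radius `r` inside `T`.
  wlog hρr : ρ ≤ min 1 (r / 2) generalizing ρ
  · obtain ⟨ν, hν, h⟩ := this (lt_min one_pos (half_pos hr)) le_rfl
    have hle := (not_le.1 hρr).le
    refine ⟨ν, hν, h.mono fun n hn θ hθ hl => ?_⟩
    obtain ⟨h1, h2, h3⟩ := hn θ hθ hl
    exact ⟨h1.trans hle, h2.trans hle, h3.trans hle⟩
  obtain ⟨ε₀, hε₀, hnear⟩ := near_lattice_of_weylMean_near_one hρ (hρr.trans (min_le_left _ _))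
  set ε₁ := min ε₀ (1 / 2)
  have hε₁ : 0 < ε₁ := lt_min hε₀ (by norm_num)
  set ε := min ρ (ε₁ / 2)
  have hε : 0 < ε := lt_min hρ (by positivity)
  have hC0 : 0 < ‖C‖ := norm_pos_iff.2 hC
  refine ⟨‖C‖ * (ε₁ / 2), by positivity, ?_⟩
  filter_upwards [eventually_weylMean_small_or_small hθ hε, eventually_ge_atTop 4]
    with n hn hn4 θ hθmem hlarge
  have hsum : 1 - ε₁ / 2 ≤ ‖weylMean n (θ₀ - θ)‖ + ‖weylMean n (-θ₀ - θ)‖ := by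
    have h1 := hlarge.trans (norm_add_le _ _)
    rw [norm_mul, norm_mul, RCLike.norm_conj] at h1
    refine le_of_mul_le_mul_left (?_ : ‖C‖ * _ ≤ ‖C‖ * _) hC0
    linarith
  have hεε₁ : ε ≤ ε₁ / 2 := min_le_right _ _
  have hε₁ε₀ : ε₁ ≤ ε₀ := min_le_left _ _
  have hε₁2 : ε₁ ≤ 1 / 2 := min_le_right _ _
  have hmem : ∀ η : ℝ × ℝ, |θ₀.1 - η.1| ≤ ρ → |θ₀.2 - η.2| ≤ ρ → η ∈ T := by
    intro η h1 h2
    have hle := hρr.trans (min_le_right _ _)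
    apply hball
    rw [Metric.mem_ball, dist_comm, Prod.dist_eq, max_lt_iff, Real.dist_eq, Real.dist_eq]
    constructor <;> linarith
  rcases hn θ with hsmall | hsmall
  · exfalso
    obtain ⟨-, a, k, h1, h2⟩ := hnear n hn4 (-θ₀ - θ) (by linarith)
    set l : ℝ × ℝ := (2 * Real.pi * k - Real.pi * a, Real.pi * a) with hl
    have hmem' : -(θ + l) ∈ T := by
      refine hmem _ (le_trans (le_of_eq ?_) h1) (le_trans (le_of_eq ?_) h2)
      · rw [← abs_neg]; congr 1; simp [hl]; ring
      · rw [← abs_neg]; congr 1; simp [hl]; ring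
    -- In this branch `θ` is its own reflection modulo the lattice, so both Weyl means have the same
    -- modulus; but one is small and the other near one.
    have heq : -(θ + l) = θ := hT hmem' hθmem (by
      rw [chirpFamily_neg, chirpFamily_add_lattice])
    have hW : ‖weylMean n (θ₀ - θ)‖ = ‖weylMean n (-θ₀ - θ)‖ := by
      have h3 : θ₀ - θ = -(-θ₀ - θ) + l := by
        nth_rewrite 1 [← heq]
        abel
      rw [h3, weylMean_add_lattice, norm_weylMean_neg]
    linarith
  · obtain ⟨h0, a, k, h1, h2⟩ := hnear n hn4 (θ₀ - θ) (by linarith)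
    set l : ℝ × ℝ := (2 * Real.pi * k - Real.pi * a, Real.pi * a) with hl
    have e1 : θ₀.1 - (θ + l).1 = (θ₀ - θ).1 - (2 * Real.pi * k - Real.pi * a) := by
      simp [hl]; ring
    have e2 : θ₀.2 - (θ + l).2 = (θ₀ - θ).2 - Real.pi * a := by simp [hl]; ring
    rw [← e1] at h1
    rw [← e2] at h2
    have heq : θ + l = θ := hT (hmem _ h1 h2) hθmem (chirpFamily_add_lattice θ a k)
    rw [heq] at h1 h2
    refine ⟨?_, h0, hsmall.le.trans (min_le_left _ _)⟩
    rw [dist_comm, Prod.dist_eq]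
    exact max_le h1 h2

/-! ### Correlations of the data and deterministic consistency. -/

/-- The mean of `y(t) exp (-i (θ₁ t + θ₂ t²))` over `t = 1, …, n`. -/
noncomputable def chirpCorrelation (y : ℕ → ℝ) (n : ℕ) (θ : ℝ × ℝ) : ℂ :=
  (n : ℂ)⁻¹ * ∑ t ∈ Finset.Icc 1 n, (y t : ℂ) * cis (-chirpPhase θ t)

lemma chirpPeriodogram_eq (y : ℕ → ℝ) {n : ℕ} (hn : 0 < n) (θ : ℝ × ℝ) :
    chirpPeriodogram y n θ = 2 * n * ‖chirpCorrelation y n θ‖ ^ 2 := by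
  have hn' : (n : ℝ) ≠ 0 := by exact_mod_cast hn.ne'
  have h : ∀ t, Complex.exp (-(Complex.I * (chirpPhase θ t : ℂ))) = cis (-chirpPhase θ t) :=
    fun t => by rw [cis]; push_cast; ring_nf
  simp only [chirpPeriodogram, chirpCorrelation, h, norm_mul, norm_inv, Complex.norm_natCast]
  field_simp

lemma alseA_eq (y : ℕ → ℝ) (n : ℕ) (θ : ℝ × ℝ) :
    alseA y n θ = 2 * (chirpCorrelation y n θ).re := by
  have h : (n : ℂ)⁻¹ = (((n : ℝ)⁻¹ : ℝ) : ℂ) := by push_cast; rfl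
  rw [alseA, chirpCorrelation, h, Complex.re_ofReal_mul, Complex.re_sum]
  simp_rw [Complex.re_ofReal_mul, cis_re, Real.cos_neg]
  ring

lemma alseB_eq (y : ℕ → ℝ) (n : ℕ) (θ : ℝ × ℝ) :
    alseB y n θ = -2 * (chirpCorrelation y n θ).im := by
  have h : (n : ℂ)⁻¹ = (((n : ℝ)⁻¹ : ℝ) : ℂ) := by push_cast; rfl
  rw [alseB, chirpCorrelation, h, Complex.im_ofReal_mul, Complex.im_sum]
  simp_rw [Complex.im_ofReal_mul, cis_im, Real.sin_neg, mul_neg, Finset.sum_neg_distrib]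
  ring

/-- The complex amplitude `(A - i B) / 2` of a chirp signal. -/
noncomputable def complexAmplitude (A B : ℝ) : ℂ := ⟨A / 2, -B / 2⟩

lemma chirpSignal_eq_complex (A B : ℝ) (θ : ℝ × ℝ) (t : ℕ) :
    (chirpSignal A B θ t : ℂ) = complexAmplitude A B * cis (chirpPhase θ t) +
      (starRingEnd ℂ) (complexAmplitude A B) * cis (-chirpPhase θ t) := by
  apply Complex.ext
  · rw [Complex.ofReal_re]
    simp [chirpSignal, complexAmplitude, cis_re, cis_im]; ring
  · simp [complexAmplitude, cis_re, cis_im]; ring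

lemma chirpCorrelation_eq {A B : ℝ} {θ₀ : ℝ × ℝ} {y e : ℕ → ℝ}
    (hy : ∀ t, 1 ≤ t → y t = chirpSignal A B θ₀ t + e t) (n : ℕ) (θ : ℝ × ℝ) :
    chirpCorrelation y n θ = complexAmplitude A B * weylMean n (θ₀ - θ) +
      (starRingEnd ℂ) (complexAmplitude A B) * weylMean n (-θ₀ - θ) +
      chirpCorrelation e n θ := by
  have h : ∑ t ∈ Finset.Icc 1 n, (y t : ℂ) * cis (-chirpPhase θ t) =
      complexAmplitude A B * ∑ t ∈ Finset.Icc 1 n, cis (chirpPhase (θ₀ - θ) t) +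
      (starRingEnd ℂ) (complexAmplitude A B) *
        ∑ t ∈ Finset.Icc 1 n, cis (chirpPhase (-θ₀ - θ) t) +
      ∑ t ∈ Finset.Icc 1 n, (e t : ℂ) * cis (-chirpPhase θ t) := by
    rw [Finset.mul_sum, Finset.mul_sum, ← Finset.sum_add_distrib, ← Finset.sum_add_distrib]
    refine Finset.sum_congr rfl fun t ht => ?_
    rw [hy t (Finset.mem_Icc.1 ht).1, Complex.ofReal_add, chirpSignal_eq_complex, chirpPhase_sub,
      chirpPhase_sub, chirpPhase_neg, sub_eq_add_neg, sub_eq_add_neg, cis_add, cis_add]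
    ring
  rw [chirpCorrelation, chirpCorrelation, weylMean, weylMean, h]
  ring

lemma weylMean_zero {n : ℕ} (hn : 0 < n) : weylMean n 0 = 1 := by
  have : (n : ℂ) ≠ 0 := by exact_mod_cast hn.ne'
  simp [weylMean, chirpPhase, this]

/-- Deterministic consistency: if the correlations of the noise with all chirps vanish uniformly,
then approximate least squares estimates converge to the true parameter. -/
theorem tendsto_alse_of_uniform_noise {Θ : Set (ℝ × ℝ × ℝ × ℝ)}
    (hΘ : FrequencyIdentifiable (frequencySpace Θ)) {A B : ℝ} {θ₀ : ℝ × ℝ}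
    (hint : (A, B, θ₀.1, θ₀.2) ∈ interior Θ) (hAB : ¬ (A = 0 ∧ B = 0))
    (hθ : ¬ ((∃ r : ℚ, θ₀.1 = r * Real.pi) ∧ (∃ s : ℚ, θ₀.2 = s * Real.pi)))
    {y e : ℕ → ℝ} (hy : ∀ t, 1 ≤ t → y t = chirpSignal A B θ₀ t + e t)
    (hnoise : ∀ ε > 0, ∀ᶠ n : ℕ in atTop, ∀ θ : ℝ × ℝ,
      ‖∑ t ∈ Finset.Icc 1 n, (e t : ℂ) * cis (-chirpPhase θ t)‖ ≤ ε * n)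
    {ξ : ℕ → ℝ × ℝ × ℝ × ℝ} (hξ : ∀ᶠ n : ℕ in atTop, IsALSE Θ y n (ξ n)) :
    Tendsto ξ atTop (𝓝 (A, B, θ₀.1, θ₀.2)) := by
  set C := complexAmplitude A B with hCdef
  have hC : C ≠ 0 := by
    intro h
    apply hAB
    have h1 := congrArg Complex.re h
    have h2 := congrArg Complex.im h
    simp [hCdef, complexAmplitude] at h1 h2
    exact ⟨h1, h2⟩
  have hC0 : 0 < ‖C‖ := norm_pos_iff.2 hC
  have hTnhds : frequencySpace Θ ∈ 𝓝 θ₀ := by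
    have hcont : Continuous fun θ : ℝ × ℝ => (A, B, θ.1, θ.2) := by fun_prop
    filter_upwards [hcont.continuousAt.preimage_mem_nhds (mem_interior_iff_mem_nhds.1 hint)]
      with θ hmem
    exact ⟨A, B, hmem⟩
  have hθT : θ₀ ∈ frequencySpace Θ := mem_of_mem_nhds hTnhds
  have hnoise' : ∀ ε > 0, ∀ᶠ n : ℕ in atTop, ∀ θ : ℝ × ℝ, ‖chirpCorrelation e n θ‖ ≤ ε := by
    intro ε hε
    filter_upwards [hnoise ε hε, eventually_gt_atTop 0] with n hn hn0 θ
    have hn0' : (0 : ℝ) < n := by exact_mod_cast hn0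
    rw [chirpCorrelation, norm_mul, norm_inv, Complex.norm_natCast, inv_mul_le_iff₀ hn0', mul_comm]
    exact hn θ
  have key : ∀ ρ > 0, ∀ᶠ n : ℕ in atTop, dist (ξ n).2.2 θ₀ ≤ ρ ∧
      ‖chirpCorrelation y n (ξ n).2.2 - C‖ ≤ (2 * ‖C‖ + 1) * ρ := by
    intro ρ hρ
    obtain ⟨ν, hν, hclose⟩ := frequency_close_of_large_correlation hΘ hTnhds hθ hC hρ
    -- The cap at `1` rules out the first alternative at `θ = θ₀`, where that Weyl mean equals one;
    -- the conjugate term is then the small one.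
    have hν' : 0 < min (ν / (4 * ‖C‖)) 1 := lt_min (by positivity) one_pos
    filter_upwards [hclose, hnoise' (min (ν / 4) ρ) (lt_min (by positivity) hρ),
      eventually_weylMean_small_or_small hθ hν', hξ, eventually_gt_atTop 0]
      with n hn hnoise_n hsmall hξn hn0
    obtain ⟨hmem, hmax, -, -⟩ := hξn
    have hn0' : (0 : ℝ) < n := by exact_mod_cast hn0
    have hle : ‖chirpCorrelation y n θ₀‖ ≤ ‖chirpCorrelation y n (ξ n).2.2‖ := by
      have h1 : chirpPeriodogram y n θ₀ ≤ chirpPeriodogram y n (ξ n).2.2 := hmax hθT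
      rw [chirpPeriodogram_eq y hn0, chirpPeriodogram_eq y hn0] at h1
      have h2 := le_of_mul_le_mul_left h1 (by positivity)
      exact le_of_sq_le_sq h2 (norm_nonneg _)
    have hW : ‖C‖ * ‖weylMean n (-θ₀ - θ₀)‖ ≤ ν / 4 := by
      have h1 : ‖weylMean n (-θ₀ - θ₀)‖ < min (ν / (4 * ‖C‖)) 1 := by
        refine (hsmall θ₀).resolve_left ?_
        rw [sub_self, weylMean_zero hn0, norm_one, not_lt]
        exact min_le_right _ _
      have h2 := h1.le.trans (min_le_left _ _)
      rw [le_div_iff₀ (by positivity)] at h2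
      linarith
    have hlow : ‖C‖ - ν / 2 ≤ ‖chirpCorrelation y n θ₀‖ := by
      have h1 := chirpCorrelation_eq hy n θ₀
      rw [sub_self, weylMean_zero hn0, mul_one, ← hCdef] at h1
      have h2 : C = chirpCorrelation y n θ₀ -
          ((starRingEnd ℂ) C * weylMean n (-θ₀ - θ₀) + chirpCorrelation e n θ₀) := by
        rw [h1]; ring
      have h3 : ‖(starRingEnd ℂ) C * weylMean n (-θ₀ - θ₀) + chirpCorrelation e n θ₀‖ ≤
          ν / 4 + ν / 4 := by
        refine (norm_add_le _ _).trans (add_le_add ?_ ((hnoise_n θ₀).trans (min_le_left _ _)))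
        rwa [norm_mul, RCLike.norm_conj]
      have h4 := norm_sub_le (chirpCorrelation y n θ₀)
        ((starRingEnd ℂ) C * weylMean n (-θ₀ - θ₀) + chirpCorrelation e n θ₀)
      rw [← h2] at h4
      linarith
    set θ := (ξ n).2.2
    have hdec := chirpCorrelation_eq hy n θ
    rw [← hCdef] at hdec
    obtain ⟨h1, h2, h3⟩ := hn θ hmem (by
      have h5 : ‖chirpCorrelation y n θ‖ ≤
          ‖C * weylMean n (θ₀ - θ) + (starRingEnd ℂ) C * weylMean n (-θ₀ - θ)‖ + ν / 4 := by
        rw [hdec]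
        exact (norm_add_le _ _).trans (add_le_add le_rfl ((hnoise_n θ).trans (min_le_left _ _)))
      linarith)
    refine ⟨h1, ?_⟩
    have h6 : chirpCorrelation y n θ - C = C * (weylMean n (θ₀ - θ) - 1) +
        (starRingEnd ℂ) C * weylMean n (-θ₀ - θ) + chirpCorrelation e n θ := by
      rw [hdec]; ring
    rw [h6]
    refine norm_add₃_le.trans ?_
    rw [norm_mul, norm_mul, RCLike.norm_conj]
    have h7 := (hnoise_n θ).trans (min_le_right _ _)
    calc _ ≤ ‖C‖ * ρ + ‖C‖ * ρ + ρ := by gcongr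
      _ = _ := by ring
  have hfreq : Tendsto (fun n => (ξ n).2.2) atTop (𝓝 θ₀) := by
    rw [Metric.tendsto_nhds]
    intro ε hε
    filter_upwards [key (ε / 2) (by positivity)] with n hn
    linarith [hn.1]
  have hcorr : Tendsto (fun n => chirpCorrelation y n (ξ n).2.2) atTop (𝓝 C) := by
    rw [Metric.tendsto_nhds]
    intro ε hε
    filter_upwards [key (ε / (2 * (2 * ‖C‖ + 1))) (by positivity)] with n hn
    rw [dist_eq_norm]
    refine hn.2.trans_lt ?_
    have : (2 * ‖C‖ + 1) * (ε / (2 * (2 * ‖C‖ + 1))) = ε / 2 := by field_simp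
    linarith
  have hA : Tendsto (fun n => (ξ n).1) atTop (𝓝 A) := by
    have h1 := ((Complex.continuous_re.tendsto C).comp hcorr).const_mul 2
    have h2 : 2 * C.re = A := by simp only [hCdef, complexAmplitude]; ring
    rw [h2] at h1
    refine h1.congr' ?_
    filter_upwards [hξ] with n hn
    rw [hn.2.2.1, alseA_eq]; rfl
  have hB : Tendsto (fun n => (ξ n).2.1) atTop (𝓝 B) := by
    have h1 := ((Complex.continuous_im.tendsto C).comp hcorr).const_mul (-2)
    have h2 : -2 * C.im = B := by simp only [hCdef, complexAmplitude]; ring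
    rw [h2] at h1
    refine h1.congr' ?_
    filter_upwards [hξ] with n hn
    rw [hn.2.2.2, alseB_eq]; rfl
  exact hA.prodMk_nhds (hB.prodMk_nhds hfreq)

/-! ### The theorem. -/

/-- Follows from `|X| ≤ |X|^p + 1`; the moment condition enters the proof through this
integrability. -/
lemma integrable_of_integrable_abs_rpow {Ω : Type*} [MeasurableSpace Ω] {μ : Measure Ω}
    [IsFiniteMeasure μ] {X : Ω → ℝ} (hX : AEMeasurable X μ) {p : ℝ} (hp : 1 ≤ p)
    (h : Integrable (fun ω => |X ω| ^ p) μ) : Integrable X μ := by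
  refine (h.add (integrable_const (1 : ℝ))).mono' hX.aestronglyMeasurable
    (Eventually.of_forall fun ω => ?_)
  simp only [Real.norm_eq_abs, Pi.add_apply]
  rcases le_total |X ω| 1 with h1 | h1
  · have := Real.rpow_nonneg (abs_nonneg (X ω)) p
    linarith
  · have := Real.rpow_le_rpow_of_exponent_le h1 hp
    rw [Real.rpow_one] at this
    linarith

theorem theorem2p2
    {Ω : Type*} [MeasurableSpace Ω] (μ : Measure Ω) [IsProbabilityMeasure μ]
    (Θ : Set (ℝ × ℝ × ℝ × ℝ)) (hΘ : FrequencyIdentifiable (frequencySpace Θ))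
    (A₀ B₀ θ₁ θ₂ : ℝ) (hint : (A₀, B₀, θ₁, θ₂) ∈ interior Θ)
    (hAB : ¬ (A₀ = 0 ∧ B₀ = 0))
    (hθ : ¬ ((∃ r : ℚ, θ₁ = r * Real.pi) ∧ (∃ s : ℚ, θ₂ = s * Real.pi)))
    (e : ℕ → Ω → ℝ) (δ : ℝ) (hδ₀ : 0 < δ) (hδ₁ : δ < 1)
    (hindep : iIndepFun (fun t : ℕ => e (t + 1)) μ)
    (hident : ∀ t : ℕ, IdentDistrib (e (t + 1)) (e 1) μ μ)
    (hmoment : Integrable (fun ω => |e 1 ω| ^ (1 + δ)) μ)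
    (hmean : ∫ ω, e 1 ω ∂μ = 0)
    (y : ℕ → Ω → ℝ)
    (hy : ∀ t : ℕ, 1 ≤ t → ∀ ω, y t ω = chirpSignal A₀ B₀ (θ₁, θ₂) t + e t ω)
    (ξ : ℕ → Ω → ℝ × ℝ × ℝ × ℝ)
    (hξ : ∀ᵐ ω ∂μ, ∀ᶠ n : ℕ in atTop, IsALSE Θ (fun t => y t ω) n (ξ n ω)) :
    ∀ᵐ ω ∂μ, Tendsto (fun n : ℕ => ξ n ω) atTop (𝓝 (A₀, B₀, θ₁, θ₂)) := by
  have hmeas : AEMeasurable (e 1) μ := (hident 0).aemeasurable_snd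
  have hinte : Integrable (e 1) μ :=
    integrable_of_integrable_abs_rpow hmeas (by linarith) hmoment
  filter_upwards [ae_uniform_chirp_mean hindep hident hinte hmean, hξ] with ω hnoise hξω
  exact tendsto_alse_of_uniform_noise (θ₀ := (θ₁, θ₂)) hΘ hint hAB hθ
    (fun t ht => hy t ht ω) hnoise hξω
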